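/- \textbf{Proposition (PBW for the trigonometric double affine Hecke--Clifford algebra).} Let $n\ge 0$ be an integer and $u\in\mathbb C$. Let $P=\bigoplus_{i=1}^n\mathbb Z\epsilon_i$ be the weight lattice of type $GL_n$, with $S_n$ acting by $\sigma\epsilon_i=\epsilon_{\sigma i}$, let $\mathbb C[P]$ be its group algebra with basis $e^\eta$ $(\eta\in P)$, let $s_{ki}\in S_n$ be the transposition of $k$ and $i$, and let $s_i=s_{i,i+1}$. Let $\mathcal C_n$ be the complex Clifford algebra on $c_1,\dots,c_n$ with $c_i^2=1$ and $c_ic_j=-c_jc_i$ for $i\ne j$. Let $\ddot{\mathfrak H}^{\mathfrak c}_{tr}$ be the unital associative $\mathbb C$-algebra generated by $e^{\pm\epsilon_i},\epsilon_i^\vee,c_i$ $(1\le i\le n)$ and the group $S_n$, subject to the relations (for all admissible $i,j$, all $\sigma\in S_n$ and all $\eta\in P$) $$c_i^2=1,\qquad c_ic_j=-c_jc_i\ (i\ne j),\qquad e^{\epsilon_i}e^{-\epsilon_i}=e^{-\epsilon_i}e^{\epsilon_i}=1,\qquad e^{\epsilon_i}e^{\epsilon_j}=e^{\epsilon_j}e^{\epsilon_i},$$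 $$\epsilon_i^\vee\epsilon_j^\vee=\epsilon_j^\vee\epsilon_i^\vee,\qquad c_je^{\epsilon_i}=e^{\epsilon_i}c_j,\qquad \sigma e^{\epsilon_i}=e^{\epsilon_{\sigma i}}\sigma,\qquad \sigma c_i=c_{\sigma i}\sigma,$$ $$c_i\epsilon_i^\vee=-\epsilon_i^\vee c_i,\qquad c_j\epsilon_i^\vee=\epsilon_i^\vee c_j\ (i\neq j),$$ $$\epsilon_{i+1}^\vee s_i-s_i\epsilon_i^\vee=u(1-c_{i+1}c_i),\qquad \epsilon_j^\vee s_i=s_i\epsilon_j^\vee\ (j\ne i,i+1),$$ $$[\epsilon_i^\vee,e^\eta]=u\sum_{k\ne i}\operatorname{sgn}(k-i)\,\frac{e^\eta-e^{s_{ki}(\eta)}}{1-e^{\operatorname{sgn}(k-i)(\epsilon_k-\epsilon_i)}}\,(1-c_ic_k)\,s_{ki},$$ where $e^\eta$ denotes the monomial in the $e^{\pm\epsilon_i}$ attached to $\eta$, and the quotient is the exact quotient in $\mathbb C[P]$. Then the canonical algebra homomorphisms from $\mathbb C[P]$, $\mathbb C S_n$, $\mathcal C_n$ and the polynomial algebra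 $\mathbb C[\epsilon_1^\vee,\dots,\epsilon_n^\vee]$ to $\ddot{\mathfrak H}^{\mathfrak c}_{tr}$ are injective, so that these algebras are identified with subalgebras, and multiplication of these subalgebras, $p\otimes w\otimes c\otimes f\mapsto p\,w\,c\,f$, is an isomorphism of vector spaces $$\mathbb C[P]\otimes\mathbb C S_n\otimes\mathcal C_n\otimes\mathbb C[\epsilon_1^\vee,\dots,\epsilon_n^\vee]\ \xrightarrow{\ \cong\ }\ \ddot{\mathfrak H}^{\mathfrak c}_{tr}.$$ -/

import Mathlib

open scoped TensorProduct

noncomputable section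

namespace TrigDaHCa

/-! ### The weight lattice of type `GL_n` and its group algebra -/

/-- The weight lattice `P` of type `GL_n`, the free abelian group on `ε_1, …, ε_n`;
the weight `∑ η_i ε_i` is the function `i ↦ η_i`. -/
abbrev Weight (n : ℕ) : Type := Fin n → ℤ

/-- The basis weight `ε_i`. -/
abbrev ep {n : ℕ} (i : Fin n) : Weight n := Pi.single i 1

/-- The group algebra `ℂ[P]`; `e^η` is `AddMonoidAlgebra.single η 1`. -/
abbrev GroupAlg (n : ℕ) : Type := AddMonoidAlgebra ℂ (Weight n)

/-- The element `e^η` of `ℂ[P]`. -/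
abbrev ex {n : ℕ} (η : Weight n) : GroupAlg n := AddMonoidAlgebra.single η 1

/-- The action of `S_n` on `P` by `σ ε_i = ε_{σ i}`. -/
def permWeight {n : ℕ} (σ : Equiv.Perm (Fin n)) (η : Weight n) : Weight n :=
  fun i => η (σ.symm i)

theorem permWeight_ep {n : ℕ} (σ : Equiv.Perm (Fin n)) (i : Fin n) :
    permWeight σ (ep i) = ep (σ i) := by
  funext j
  by_cases h : j = σ i
  · subst h; simp [permWeight]
  · have h2 : σ.symm j ≠ i := fun h3 => h (by rw [← h3]; simp)
    simp [permWeight, h, h2]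

/-- `sgn (k - i)`. -/
def sg {n : ℕ} (i k : Fin n) : ℤ := Int.sign ((k : ℤ) - (i : ℤ))

/-- The root `sgn (k - i) (ε_k - ε_i)`. -/
def rt {n : ℕ} (i k : Fin n) : Weight n := sg i k • (ep k - ep i)

/-- The divided difference `(e^η - e^{s_{ki} η}) / (1 - e^{sgn (k - i) (ε_k - ε_i)})` in `ℂ[P]`,
for `k ≠ i`, written out as a finite geometric sum. It is characterised by
`divDiff_mul` and `divDiff_unique`. -/
def divDiff {n : ℕ} (i k : Fin n) (η : Weight n) : GroupAlg n :=
  (∑ t ∈ Finset.range (-(sg i k * (η k - η i))).toNat, ex (η + (t : ℤ) • rt i k))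
    - ∑ t ∈ Finset.range (sg i k * (η k - η i)).toNat, ex (η - ((t : ℤ) + 1) • rt i k)

theorem sg_mul_self {n : ℕ} {i k : Fin n} (h : k ≠ i) : sg i k * sg i k = 1 := by
  have h1 : (k : ℤ) - (i : ℤ) ≠ 0 := by
    intro h2
    apply h
    ext
    omega
  unfold sg
  rcases lt_or_gt_of_ne h1 with h2 | h2
  · simp [Int.sign_eq_neg_one_of_neg h2]
  · simp [Int.sign_eq_one_of_pos h2]

theorem permWeight_swap {n : ℕ} {i k : Fin n} (h : k ≠ i) (η : Weight n) :
    permWeight (Equiv.swap k i) η = η - (sg i k * (η k - η i)) • rt i k := by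
  have h1 : (sg i k * (η k - η i)) • rt i k = (η k - η i) • (ep k - ep i : Weight n) := by
    rw [rt, smul_smul, mul_right_comm, sg_mul_self h, one_mul]
  rw [h1]
  funext j
  by_cases hk : j = k
  · subst hk; simp [permWeight, h]
  · by_cases hi : j = i
    · subst hi; simp [permWeight, Ne.symm h]
    · simp [permWeight, Equiv.swap_apply_of_ne_of_ne hk hi, hk, hi]

theorem ex_mul {n : ℕ} (η θ : Weight n) : ex η * ex θ = ex (η + θ) := by
  simp [AddMonoidAlgebra.single_mul_single]

theorem divDiff_mul {n : ℕ} {i k : Fin n} (h : k ≠ i) (η : Weight n) :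
    divDiff i k η * (1 - ex (rt i k)) = ex η - ex (permWeight (Equiv.swap k i) η) := by
  rw [permWeight_swap h, divDiff]
  generalize sg i k * (η k - η i) = m
  generalize rt i k = α
  have hA : ∀ N : ℕ, (∑ t ∈ Finset.range N, ex (η + (t : ℤ) • α)) * (1 - ex α)
      = ex η - ex (η + (N : ℤ) • α) := by
    intro N
    induction N with
    | zero => simp
    | succ N ih =>
      rw [Finset.sum_range_succ, add_mul, ih, mul_sub, ex_mul, mul_one]
      have : η + (N : ℤ) • α + α = η + ((N + 1 : ℕ) : ℤ) • α := by
        push_cast; rw [add_smul, one_smul, add_assoc]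
      rw [this]; abel
  have hB : ∀ N : ℕ, (∑ t ∈ Finset.range N, ex (η - ((t : ℤ) + 1) • α)) * (1 - ex α)
      = ex (η - (N : ℤ) • α) - ex η := by
    intro N
    induction N with
    | zero => simp
    | succ N ih =>
      rw [Finset.sum_range_succ, add_mul, ih, mul_sub, ex_mul, mul_one]
      have : η - ((N : ℤ) + 1) • α + α = η - (N : ℤ) • α := by
        rw [add_smul, one_smul]; abel
      rw [this]; push_cast; abel
  rw [sub_mul, hA, hB]
  rcases le_total 0 m with hm | hm
  · have h1 : (-m).toNat = 0 := by omega
    have h2 : ((m.toNat : ℕ) : ℤ) = m := by omega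
    rw [h1, h2]; simp
  · have h1 : m.toNat = 0 := by omega
    have h2 : (((-m).toNat : ℕ) : ℤ) = -m := by omega
    rw [h1, h2]; simp [sub_eq_add_neg]

theorem divDiff_unique {n : ℕ} {i k : Fin n} (h : k ≠ i) (η : Weight n) (q : GroupAlg n)
    (hq : q * (1 - ex (rt i k)) = ex η - ex (permWeight (Equiv.swap k i) η)) :
    q = divDiff i k η := by
  have h0 : (1 - ex (rt i k) : GroupAlg n) ≠ 0 := by
    intro h1
    have h2 : (ex (0 : Weight n)) = ex (rt i k) := by
      have h3 : (ex (0 : Weight n)) = 1 := AddMonoidAlgebra.one_def.symm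
      rw [h3]; exact sub_eq_zero.mp h1
    have h3 : (0 : Weight n) = rt i k :=
      AddMonoidAlgebra.single_left_injective (one_ne_zero) h2
    have h4 := congrFun h3 k
    have h5 := sg_mul_self h
    simp [rt, h] at h4
    simp [← h4] at h5
  exact mul_right_cancel₀ h0 (hq.trans (divDiff_mul h η).symm)

/-! ### The algebra by generators and relations -/

/-- The generators `e^{ε_i}`, `e^{-ε_i}`, `ε_i^∨`, `c_i` and the elements of `S_n`. -/
inductive Gen (n : ℕ) : Type
  | expPos (i : Fin n) : Gen n
  | expNeg (i : Fin n) : Gen n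
  | coroot (i : Fin n) : Gen n
  | cliff (i : Fin n) : Gen n
  | perm (σ : Equiv.Perm (Fin n)) : Gen n

/-- The free algebra on the generators. -/
abbrev Free (n : ℕ) : Type := FreeAlgebra ℂ (Gen n)

/-- The free generators, in the order of `Gen`. -/
abbrev fE {n : ℕ} (i : Fin n) : Free n := FreeAlgebra.ι ℂ (Gen.expPos i)
abbrev fE' {n : ℕ} (i : Fin n) : Free n := FreeAlgebra.ι ℂ (Gen.expNeg i)
abbrev fV {n : ℕ} (i : Fin n) : Free n := FreeAlgebra.ι ℂ (Gen.coroot i)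
abbrev fC {n : ℕ} (i : Fin n) : Free n := FreeAlgebra.ι ℂ (Gen.cliff i)
abbrev fS {n : ℕ} (σ : Equiv.Perm (Fin n)) : Free n := FreeAlgebra.ι ℂ (Gen.perm σ)

/-- The monomial `e^η = ∏_i (e^{ε_i})^{η_i}` in the generators `e^{±ε_i}`. -/
def expWord {n : ℕ} (η : Weight n) : Free n :=
  ((List.finRange n).map fun i => fE i ^ (η i).toNat * fE' i ^ (-η i).toNat).prod

/-- An element of `ℂ[P]` written in the generators `e^{±ε_i}`: the linear extension of
`e^η ↦ expWord η`. -/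
def expLift {n : ℕ} (f : GroupAlg n) : Free n :=
  f.coeff.sum fun η a => a • expWord η

/-- The defining relations of the trigonometric double affine Hecke-Clifford algebra. -/
inductive Rel (n : ℕ) (u : ℂ) : Free n → Free n → Prop
  | perm_one : Rel n u (fS 1) 1
  | perm_mul (σ τ : Equiv.Perm (Fin n)) : Rel n u (fS σ * fS τ) (fS (σ * τ))
  | cliff_sq (i : Fin n) : Rel n u (fC i * fC i) 1
  | cliff_anti (i j : Fin n) (h : i ≠ j) : Rel n u (fC i * fC j) (-(fC j * fC i))
  | exp_mul_inv (i : Fin n) : Rel n u (fE i * fE' i) 1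
  | exp_inv_mul (i : Fin n) : Rel n u (fE' i * fE i) 1
  | exp_comm (i j : Fin n) : Rel n u (fE i * fE j) (fE j * fE i)
  | coroot_comm (i j : Fin n) : Rel n u (fV i * fV j) (fV j * fV i)
  | cliff_exp (i j : Fin n) : Rel n u (fC j * fE i) (fE i * fC j)
  | perm_exp (σ : Equiv.Perm (Fin n)) (i : Fin n) : Rel n u (fS σ * fE i) (fE (σ i) * fS σ)
  | perm_cliff (σ : Equiv.Perm (Fin n)) (i : Fin n) : Rel n u (fS σ * fC i) (fC (σ i) * fS σ)
  | cliff_coroot (i : Fin n) : Rel n u (fC i * fV i) (-(fV i * fC i))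
  | cliff_coroot_ne (i j : Fin n) (h : i ≠ j) : Rel n u (fC j * fV i) (fV i * fC j)
  /-- `ε_{i'}^∨ s_i - s_i ε_i^∨ = u (1 - c_{i'} c_i)` where `i' = i + 1`. -/
  | coroot_simple (i i' : Fin n) (h : (i' : ℕ) = i + 1) :
      Rel n u (fV i' * fS (Equiv.swap i i') - fS (Equiv.swap i i') * fV i)
        (u • (1 - fC i' * fC i))
  | coroot_simple_ne (i i' j : Fin n) (h : (i' : ℕ) = i + 1) (hi : j ≠ i) (hi' : j ≠ i') :
      Rel n u (fV j * fS (Equiv.swap i i')) (fS (Equiv.swap i i') * fV j)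
  | coroot_exp (i : Fin n) (η : Weight n) :
      Rel n u (fV i * expWord η - expWord η * fV i)
        (u • ∑ k ∈ Finset.univ.erase i,
          (sg i k : ℂ) • (expLift (divDiff i k η) * (1 - fC i * fC k) * fS (Equiv.swap k i)))

end TrigDaHCa

open TrigDaHCa in
/-- The trigonometric double affine Hecke-Clifford algebra with parameter `u`. -/
abbrev TrigDaHCa (n : ℕ) (u : ℂ) : Type := RingQuot (TrigDaHCa.Rel n u)

namespace TrigDaHCa

variable (n : ℕ) (u : ℂ)

/-- The quotient map from the free algebra. -/
def mk : Free n →ₐ[ℂ] TrigDaHCa n u := RingQuot.mkAlgHom ℂ (Rel n u)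

variable {n}

theorem mk_rel {a b : Free n} (h : Rel n u a b) : mk n u a = mk n u b :=
  RingQuot.mkAlgHom_rel ℂ h

/-- The images of the generators in the algebra: `e^{ε_i}`, `e^{-ε_i}`, `ε_i^∨`, `c_i`, `σ`. -/
def gE (i : Fin n) : TrigDaHCa n u := mk n u (fE i)
def gE' (i : Fin n) : TrigDaHCa n u := mk n u (fE' i)
def gV (i : Fin n) : TrigDaHCa n u := mk n u (fV i)
def gC (i : Fin n) : TrigDaHCa n u := mk n u (fC i)
def gS (σ : Equiv.Perm (Fin n)) : TrigDaHCa n u := mk n u (fS σ)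

/-! ### The canonical homomorphisms onto the four subalgebras -/

/-- `e^{ε_i}` as a unit. -/
def unitE (i : Fin n) : (TrigDaHCa n u)ˣ where
  val := gE u i
  inv := gE' u i
  val_inv := by simpa [gE, gE'] using mk_rel u (Rel.exp_mul_inv i)
  inv_val := by simpa [gE, gE'] using mk_rel u (Rel.exp_inv_mul i)

theorem unitE_commute (i j : Fin n) : Commute (unitE u i) (unitE u j) := by
  apply Units.ext
  simpa [unitE, gE] using mk_rel u (Rel.exp_comm i j)

theorem mk_expWord (η : Weight n) :
    mk n u (expWord η) = (((List.finRange n).map fun i => unitE u i ^ η i).prod :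
      (TrigDaHCa n u)ˣ) := by
  rw [expWord, map_list_prod, ← Units.coeHom_apply, map_list_prod, List.map_map, List.map_map]
  congr 1
  refine List.map_congr_left fun i _ => ?_
  simp only [Function.comp_apply, map_mul, map_pow, Units.coeHom_apply]
  rcases le_total 0 (η i) with h | h
  · obtain ⟨m, hm⟩ := Int.eq_ofNat_of_zero_le h
    simp [hm, unitE, gE]
  · obtain ⟨m, hm⟩ := Int.eq_ofNat_of_zero_le (neg_nonneg.mpr h)
    have h1 : η i = -(m : ℤ) := by omega
    simp [h1, unitE, gE', ← inv_pow]

theorem list_prod_mul {G : Type*} [Group G] {ι : Type*} (l : List ι) (f g : ι → G)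
    (h : ∀ i j, Commute (f i) (g j)) :
    (l.map fun i => f i * g i).prod = (l.map f).prod * (l.map g).prod := by
  induction l with
  | nil => simp
  | cons a l ih =>
    have h1 : Commute (g a) (l.map f).prod := by
      refine Commute.list_prod_right _ _ fun x hx => ?_
      obtain ⟨i, -, rfl⟩ := List.mem_map.mp hx
      exact (h i a).symm
    simp only [List.map_cons, List.prod_cons, ih]
    rw [mul_assoc, ← mul_assoc (g a), h1.eq]
    simp only [mul_assoc]

/-- The homomorphism `P → H`, `η ↦ e^η`, to the multiplicative monoid of the algebra. -/
def expMonoidHom : Multiplicative (Weight n) →* TrigDaHCa n u where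
  toFun η := mk n u (expWord η.toAdd)
  map_one' := by rw [mk_expWord]; simp
  map_mul' η θ := by
    rw [mk_expWord, mk_expWord, mk_expWord, ← Units.val_mul, ← list_prod_mul]
    · simp [zpow_add]
    · intro i j
      exact ((unitE_commute u i j).zpow_left _).zpow_right _

/-- The canonical homomorphism `ℂ[P] → H` sending `e^η` to `e^η`. -/
def expHom : GroupAlg n →ₐ[ℂ] TrigDaHCa n u :=
  AddMonoidAlgebra.lift ℂ (TrigDaHCa n u) (Weight n) (expMonoidHom u)

/-- The canonical homomorphism `ℂ S_n → H`. -/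
def permHom : MonoidAlgebra ℂ (Equiv.Perm (Fin n)) →ₐ[ℂ] TrigDaHCa n u :=
  MonoidAlgebra.lift ℂ (TrigDaHCa n u) (Equiv.Perm (Fin n))
    { toFun := gS u
      map_one' := by simpa [gS] using mk_rel u Rel.perm_one
      map_mul' := fun σ τ => by simpa [gS] using (mk_rel u (Rel.perm_mul σ τ)).symm }

variable (n) in
/-- The quadratic form `∑ v_i ^ 2`; its Clifford algebra is generated by the images `c_i` of the
standard basis vectors, with relations `c_i ^ 2 = 1` and `c_i c_j = - c_j c_i` for `i ≠ j`. -/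
abbrev cliffForm : QuadraticForm ℂ (Fin n → ℂ) :=
  QuadraticMap.weightedSumSquares ℂ fun _ : Fin n => (1 : ℂ)

theorem cliff_sum_sq (v : Fin n → ℂ) :
    Fintype.linearCombination ℂ (gC u) v * Fintype.linearCombination ℂ (gC u) v
      = algebraMap ℂ (TrigDaHCa n u) (cliffForm n v) := by
  have hsq : ∀ i, gC u i * gC u i = (1 : TrigDaHCa n u) := fun i => by
    simpa [gC] using mk_rel u (Rel.cliff_sq i)
  have hanti : ∀ i j : Fin n, i ≠ j → gC u i * gC u j = -(gC u j * gC u i) := fun i j h => by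
    simpa [gC] using mk_rel u (Rel.cliff_anti i j h)
  have key : ∀ s : Finset (Fin n), (∑ i ∈ s, v i • gC u i) * (∑ i ∈ s, v i • gC u i)
      = algebraMap ℂ (TrigDaHCa n u) (∑ i ∈ s, v i * v i) := by
    intro s
    induction s using Finset.induction_on with
    | empty => simp
    | insert a s ha ih =>
      have hx : (v a • gC u a) * (∑ i ∈ s, v i • gC u i)
          = -((∑ i ∈ s, v i • gC u i) * (v a • gC u a)) := by
        rw [Finset.mul_sum, Finset.sum_mul, ← Finset.sum_neg_distrib]
        refine Finset.sum_congr rfl fun i hi => ?_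
        have hne : a ≠ i := fun h => ha (h ▸ hi)
        rw [smul_mul_smul_comm, smul_mul_smul_comm, hanti a i hne, smul_neg, mul_comm]
      rw [Finset.sum_insert ha, Finset.sum_insert ha, add_mul, mul_add, mul_add, ih, hx,
        smul_mul_smul_comm, hsq, map_add, Algebra.algebraMap_eq_smul_one (v a * v a)]
      abel
  rw [Fintype.linearCombination_apply, key]
  simp [QuadraticMap.weightedSumSquares_apply]

/-- The canonical homomorphism `C_n → H` sending `c_i` to `c_i`. -/
def cliffHom : CliffordAlgebra (cliffForm n) →ₐ[ℂ] TrigDaHCa n u :=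
  CliffordAlgebra.lift (cliffForm n)
    ⟨Fintype.linearCombination ℂ (gC u), cliff_sum_sq u⟩

theorem gV_comm : ∀ a ∈ Set.range (gV (n := n) u), ∀ b ∈ Set.range (gV (n := n) u),
    a * b = b * a := by
  rintro _ ⟨i, rfl⟩ _ ⟨j, rfl⟩
  simpa [gV] using mk_rel u (Rel.coroot_comm i j)

/-- The subalgebra generated by the `ε_i^∨` is commutative. -/
abbrev corootCommRing : CommRing (Algebra.adjoin ℂ (Set.range (gV (n := n) u))) :=
  { (inferInstance : Ring (Algebra.adjoin ℂ (Set.range (gV (n := n) u)))) with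
    mul_comm := (Algebra.isMulCommutative_adjoin ℂ (gV_comm u)).is_comm.comm }

/-- The canonical homomorphism `ℂ[ε_1^∨, …, ε_n^∨] → H` from the polynomial ring, sending
`ε_i^∨` to `ε_i^∨`. -/
def corootHom : MvPolynomial (Fin n) ℂ →ₐ[ℂ] TrigDaHCa n u :=
  letI := corootCommRing (n := n) u
  (Algebra.adjoin ℂ (Set.range (gV (n := n) u))).val.comp
    (MvPolynomial.aeval fun i =>
      (⟨gV u i, Algebra.subset_adjoin ⟨i, rfl⟩⟩ :
        Algebra.adjoin ℂ (Set.range (gV (n := n) u))))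

/-! The four homomorphisms are the evident ones on generators. -/

theorem expHom_ex (η : Weight n) : expHom u (ex η) = mk n u (expWord η) := by
  simp [expHom, expMonoidHom, ex]

theorem expHom_ep (i : Fin n) : expHom u (ex (ep i)) = gE u i := by
  rw [expHom_ex, mk_expWord]
  have h : (((List.finRange n).map fun j => unitE u j ^ (ep i : Weight n) j).prod)
      = unitE u i := by
    have : ∀ l : List (Fin n), l.Nodup →
        ((l.map fun j => unitE u j ^ (ep i : Weight n) j).prod)
          = if i ∈ l then unitE u i else 1 := by
      intro l
      induction l with
      | nil => simp
      | cons a l ih =>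
        intro hl
        obtain ⟨h1, h2⟩ := List.nodup_cons.mp hl
        rw [List.map_cons, List.prod_cons, ih h2]
        by_cases hai : a = i
        · subst hai; simp [h1]
        · simp [ep, hai, Ne.symm hai]
    rw [this _ (List.nodup_finRange n)]
    simp
  rw [h]; rfl

theorem permHom_single (σ : Equiv.Perm (Fin n)) :
    permHom u (MonoidAlgebra.single σ 1) = gS u σ := by
  simp [permHom]

theorem cliffHom_ι (i : Fin n) :
    cliffHom u (CliffordAlgebra.ι (cliffForm n) (Pi.single i 1)) = gC u i := by
  simp [cliffHom, Fintype.linearCombination_apply_single]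

theorem corootHom_X (i : Fin n) : corootHom u (MvPolynomial.X i) = gV u i := by
  let := corootCommRing (n := n) u
  simp [corootHom]

theorem mk_expLift (f : GroupAlg n) : mk n u (expLift f) = expHom u f := by
  rw [expHom, AddMonoidAlgebra.lift_apply, expLift, Finsupp.sum, map_sum]
  simp [Finsupp.sum, expMonoidHom]

end TrigDaHCa

end

/-!
Write `s_{ik}` for transpositions, `g_{ik} = (1 - c_i c_k) s_{ik}`, and `J_i = ∑_{k < i} g_{ik}` for
the Jucys-Murphy elements. In the coordinates `y_i = ε_i^∨ - u J_i` every relation of the algebra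
other than `[ε_i^∨, ε_j^∨] = 0` becomes equivariant under `S_n`: one has `σ y_i = y_{σ i} σ`, the
element `y_i` anticommutes with `c_i` and commutes with the other `c_j`, and
`[y_i, p] = u ∑_k Δ_{ik}(p) g_{ik}` for `p ∈ ℂ[P]`, where
`Δ_{ik}(p) = e^{ε_i} (p - s_{ik} p) / (e^{ε_i} - e^{ε_k})` is an equivariant twisted derivation
(`sub_mul_demazure`, `demazure_mul`, `permAlg_demazure`). A `DunklSystem` is a family of elements of
a `ℂ`-algebra satisfying these relations.

In a `DunklSystem` the commutator of `ε_a^∨` and `ε_b^∨`, for `a < b`, is the equivariant expression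
`curv a b = [y_a, y_b] + u [y_a, g_{ba}]` (`v_commutator`, using that the `J_i` commute), and it
commutes with `ℂ[P]` (`curv_e`); the main input is the identity `g_{ab} g_{bl} = g_{al} g_{ba}`
(`g_mul_g`). So the `ε_i^∨` commute as soon as `curv` vanishes on vectors which generate the module
under `ℂ[P]` and `S_n`.

This is applied to the module of functions `S_n → ℂ[P] ⊗ C_n ⊗ ℂ[ε^∨]`, on which the `y_i` act by
explicit formulas (`regY`), obtained by moving `ε_i^∨` to the right past `ℂ[P]` and `S_n`. On the
vectors `1 ⊗ 1 ⊗ a` the `ε_i^∨` act by multiplication on `a` (`v_baseVec`), so that `curv` vanishes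
(`regSystem_curv`), and the algebra acts on this module. Applying an ordered product `p w c f` to
`1 ⊗ 1 ⊗ 1 ⊗ 1` gives back `p ⊗ w ⊗ c ⊗ f` (`regRep_ordered`), which makes the multiplication map
injective. It is surjective because the span of the ordered products is stable under left
multiplication by the generators (`stabilizer_eq_top`).
-/

noncomputable section

namespace TrigDaHCa

/-! ### The group algebra of the weight lattice -/

/-- The action of `S_n` on `ℂ[P]` by algebra automorphisms. -/
def permAlg {n : ℕ} (σ : Equiv.Perm (Fin n)) : GroupAlg n →ₐ[ℂ] GroupAlg n :=
  AddMonoidAlgebra.mapDomainAlgHom ℂ ℂ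
    { toFun := permWeight σ
      map_zero' := rfl
      map_add' := fun _ _ => rfl }

@[simp] theorem permAlg_ex {n : ℕ} (σ : Equiv.Perm (Fin n)) (η : Weight n) :
    permAlg σ (ex η) = ex (permWeight σ η) := by
  simp [permAlg, ex]
  rfl

theorem groupAlg_induction {n : ℕ} {motive : GroupAlg n → Prop} (p : GroupAlg n)
    (hex : ∀ η, motive (ex η)) (hadd : ∀ p q, motive p → motive q → motive (p + q))
    (hsmul : ∀ (r : ℂ) p, motive p → motive (r • p)) : motive p := by
  induction p using AddMonoidAlgebra.induction_on with
  | of η => exact hex η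
  | add p q hp hq => exact hadd p q hp hq
  | smul r p hp => exact hsmul r p hp

theorem permAlg_one {n : ℕ} (p : GroupAlg n) : permAlg 1 p = p := by
  induction p using groupAlg_induction with
  | hex η => rw [permAlg_ex]; rfl
  | hadd p q hp hq => rw [map_add, hp, hq]
  | hsmul r p hp => rw [map_smul, hp]

theorem permAlg_mul {n : ℕ} (σ τ : Equiv.Perm (Fin n)) (p : GroupAlg n) :
    permAlg (σ * τ) p = permAlg σ (permAlg τ p) := by
  induction p using groupAlg_induction with
  | hex η => rw [permAlg_ex, permAlg_ex, permAlg_ex]; rfl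
  | hadd p q hp hq => simp only [map_add, hp, hq]
  | hsmul r p hp => simp only [map_smul, hp]

/-- `e^η` as the product of powers used in `expWord`. -/
theorem expWord_prod {n : ℕ} (η : Weight n) :
    ((List.finRange n).map fun i =>
      ex (ep i) ^ (η i).toNat * ex (-ep i : Weight n) ^ (-η i).toNat).prod = ex η := by
  have hex : ∀ i, ex (ep i) ^ (η i).toNat * ex (-ep i : Weight n) ^ (-η i).toNat
      = ex (η i • ep i) := fun i => by
    rw [AddMonoidAlgebra.single_pow, AddMonoidAlgebra.single_pow, one_pow, one_pow, ex_mul]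
    congr 1
    rw [smul_neg, ← sub_eq_add_neg, ← natCast_zsmul, ← natCast_zsmul, ← sub_smul]
    congr 1; omega
  have hl : ∀ l : List (Fin n), (l.map fun i => ex (η i • ep i : Weight n)).prod
      = ex (l.map fun i => η i • ep i).sum := fun l => by
    induction l with
    | nil => simp [AddMonoidAlgebra.one_def]
    | cons a l ih => rw [List.map_cons, List.prod_cons, ih, ex_mul, List.map_cons, List.sum_cons]
  simp only [hex]
  rw [hl, ← Fin.sum_univ_def]
  congr 1
  funext j
  simp [Finset.sum_apply, Pi.single_apply]

/-- Intertwining relations with `ℂ[P]` follow from those with the `e^{ε_i}`. -/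
theorem intertwine_groupAlg {n : ℕ} {R : Type*} [Ring R] [Algebra ℂ R] (E : GroupAlg n →ₐ[ℂ] R)
    (a : R) (φ : GroupAlg n →ₐ[ℂ] GroupAlg n)
    (h : ∀ i, a * E (ex (ep i)) = E (φ (ex (ep i))) * a) (p : GroupAlg n) :
    a * E p = E (φ p) * a := by
  have hmul : ∀ p q, a * E p = E (φ p) * a →
      a * E q = E (φ q) * a → a * E (p * q) = E (φ (p * q)) * a :=
    fun p q hp hq => by
      rw [map_mul, ← mul_assoc, hp, mul_assoc, hq, map_mul, map_mul, mul_assoc]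
  have hone : a * E (1 : GroupAlg n) = E (φ 1) * a := by simp
  have hpow : ∀ p, a * E p = E (φ p) * a → ∀ m : ℕ,
      a * E (p ^ m) = E (φ (p ^ m)) * a := fun p hp m => by
    induction m with
    | zero => rw [pow_zero]; exact hone
    | succ m ih => rw [pow_succ]; exact hmul _ _ ih hp
  have hinv : ∀ i, a * E (ex (-ep i)) = E (φ (ex (-ep i))) * a := fun i => by
    have e : ex (-ep i : Weight n) * ex (ep i) = 1 := by rw [ex_mul, neg_add_cancel]; rfl
    calc a * E (ex (-ep i))
        = E (φ (ex (-ep i) * ex (ep i))) * a * E (ex (-ep i)) := by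
          rw [e, map_one, map_one, one_mul]
      _ = E (φ (ex (-ep i))) * (E (φ (ex (ep i))) * a) * E (ex (-ep i)) := by
          rw [map_mul, map_mul, mul_assoc (E (φ (ex (-ep i))))]
      _ = E (φ (ex (-ep i))) * a * E (ex (-ep i) * ex (ep i)) := by
          rw [← h, mul_comm (ex (-ep i)), map_mul]; simp only [mul_assoc]
      _ = _ := by rw [e, map_one, mul_one]
  induction p using groupAlg_induction with
  | hadd p q hp hq => simp only [map_add, mul_add, add_mul, hp, hq]
  | hsmul r p hp => simp only [map_smul, mul_smul_comm, smul_mul_assoc, hp]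
  | hex η =>
    rw [← expWord_prod]
    generalize List.finRange n = l
    induction l with
    | nil => exact hone
    | cons i l ih =>
      rw [List.map_cons, List.prod_cons]
      exact hmul _ _ (hmul _ _ (hpow _ (h i) _) (hpow _ (hinv i) _)) ih

/-! ### Demazure operators -/

/-- The value of the Demazure operator on `e^η`: the signed divided difference, corrected so that
it becomes equivariant under `S_n`. For `k < i` the signed divided difference has the factor
`e^{ε_k}` in place of `e^{ε_i}`, and adding `e^η - e^{s_{ik} η}` makes up for it. -/
def demazureEx {n : ℕ} (i k : Fin n) (η : Weight n) : GroupAlg n :=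
  (sg i k : ℂ) • divDiff i k η
    + if k < i then ex η - ex (permWeight (Equiv.swap i k) η) else 0

/-- The Demazure-type operator `p ↦ e^{ε_i} (p - s_{ik} p) / (e^{ε_i} - e^{ε_k})` on `ℂ[P]`,
for `k ≠ i`; see `sub_mul_demazure`. -/
def demazure {n : ℕ} (i k : Fin n) : GroupAlg n →ₗ[ℂ] GroupAlg n :=
  (Finsupp.lsum ℂ fun η => LinearMap.toSpanSingleton ℂ (GroupAlg n) (demazureEx i k η)) ∘ₗ
    (AddMonoidAlgebra.coeffLinearEquiv ℂ).toLinearMap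

theorem demazure_ex {n : ℕ} (i k : Fin n) (η : Weight n) :
    demazure i k (ex η) = demazureEx i k η := by
  simp [demazure, ex]

theorem sub_mul_demazure {n : ℕ} {i k : Fin n} (h : k ≠ i) (p : GroupAlg n) :
    (ex (ep i) - ex (ep k)) * demazure i k p
      = ex (ep i) * (p - permAlg (Equiv.swap i k) p) := by
  induction p using groupAlg_induction with
  | hadd p q hp hq => rw [map_add, mul_add, hp, hq, map_add]; ring
  | hsmul r p hp => rw [map_smul, mul_smul_comm, hp, map_smul, ← smul_sub, mul_smul_comm]
  | hex η =>
    rw [demazure_ex, permAlg_ex, demazureEx]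
    have hd := divDiff_mul h η
    rw [Equiv.swap_comm k i] at hd
    rcases lt_or_gt_of_ne h with hlt | hlt
    · have h1 : sg i k = -1 := Int.sign_eq_neg_one_of_neg (by simpa using hlt)
      have h2 : ex (ep k) * ex (rt i k) = ex (ep i : Weight n) := by
        rw [ex_mul, rt, h1]; congr 1; simp
      rw [if_pos hlt, h1, ← h2]
      push_cast
      rw [neg_smul, one_smul]
      linear_combination (ex (ep k)) * hd
    · have h1 : sg i k = 1 := Int.sign_eq_one_of_pos (by simpa using hlt)
      have h2 : ex (ep i) * ex (rt i k) = ex (ep k : Weight n) := by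
        rw [ex_mul, rt, h1]; congr 1; simp
      rw [if_neg hlt.not_gt, h1, ← h2]
      push_cast
      rw [one_smul, add_zero]
      linear_combination (ex (ep i)) * hd

theorem ex_ep_sub_ne_zero {n : ℕ} {i k : Fin n} (h : k ≠ i) :
    (ex (ep i) - ex (ep k) : GroupAlg n) ≠ 0 := by
  intro h1
  have h2 : (ep i : Weight n) = ep k :=
    AddMonoidAlgebra.single_left_injective one_ne_zero (sub_eq_zero.mp h1)
  have h3 := congrFun h2 k
  simp [h] at h3

theorem demazure_unique {n : ℕ} {i k : Fin n} (h : k ≠ i) {p q : GroupAlg n}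
    (hq : (ex (ep i) - ex (ep k)) * q = ex (ep i) * (p - permAlg (Equiv.swap i k) p)) :
    demazure i k p = q :=
  mul_left_cancel₀ (ex_ep_sub_ne_zero h) ((sub_mul_demazure h p).trans hq.symm)

theorem demazure_mul {n : ℕ} {i k : Fin n} (h : k ≠ i) (p q : GroupAlg n) :
    demazure i k (p * q)
      = demazure i k p * permAlg (Equiv.swap i k) q + p * demazure i k q := by
  apply demazure_unique h
  rw [map_mul]
  linear_combination permAlg (Equiv.swap i k) q * sub_mul_demazure h p
    + p * sub_mul_demazure h q

theorem demazure_one {n : ℕ} {i k : Fin n} (h : k ≠ i) : demazure i k (1 : GroupAlg n) = 0 :=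
  demazure_unique h (by simp)

theorem demazure_ep_self {n : ℕ} {i k : Fin n} (h : k ≠ i) :
    demazure i k (ex (ep i)) = ex (ep i) :=
  demazure_unique h (by rw [permAlg_ex, permWeight_ep, Equiv.swap_apply_left]; ring)

theorem demazure_ep_other {n : ℕ} {i k : Fin n} (h : k ≠ i) :
    demazure i k (ex (ep k)) = -ex (ep i) :=
  demazure_unique h (by rw [permAlg_ex, permWeight_ep, Equiv.swap_apply_right]; ring)

theorem demazure_ep_of_ne {n : ℕ} {i k l : Fin n} (h : k ≠ i) (hi : l ≠ i) (hk : l ≠ k) :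
    demazure i k (ex (ep l)) = 0 :=
  demazure_unique h (by
    rw [permAlg_ex, permWeight_ep, Equiv.swap_apply_of_ne_of_ne hi hk]; ring)

theorem permAlg_demazure {n : ℕ} (σ : Equiv.Perm (Fin n)) {i k : Fin n} (h : k ≠ i)
    (p : GroupAlg n) :
    permAlg σ (demazure i k p) = demazure (σ i) (σ k) (permAlg σ p) := by
  refine (demazure_unique (σ.injective.ne h) ?_).symm
  have h1 : Equiv.swap (σ i) (σ k) * σ = σ * Equiv.swap i k := by
    rw [Equiv.swap_mul_eq_mul_swap]; simp
  rw [← permAlg_mul, h1, permAlg_mul, ← map_sub, ← permWeight_ep, ← permWeight_ep,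
    ← permAlg_ex, ← permAlg_ex, ← map_sub, ← map_mul, ← map_mul, sub_mul_demazure h]

/-! ### Equivariant systems of operators -/

section Clifford

variable {R : Type*} [Ring R] {ι : Type*} {c : ι → R}

theorem cliff_mul_one_sub_fst (hsq : ∀ i, c i * c i = 1) (a b : ι) :
    c a * (1 - c a * c b) = -((1 - c a * c b) * c b) := by
  have e1 : c a * (1 - c a * c b) = c a - (c a * c a) * c b := by noncomm_ring
  have e2 : (1 - c a * c b) * c b = c b - c a * (c b * c b) := by noncomm_ring
  rw [e1, e2, hsq, hsq]; simp

theorem cliff_mul_one_sub_snd (hsq : ∀ i, c i * c i = 1)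
    (hanti : ∀ i j, i ≠ j → c i * c j = -(c j * c i)) {a b : ι} (h : a ≠ b) :
    c b * (1 - c a * c b) = (1 - c a * c b) * c a := by
  have e1 : c b * (1 - c a * c b) = c b - c b * c a * c b := by noncomm_ring
  have e2 : (1 - c a * c b) * c a = c a - c a * (c b * c a) := by noncomm_ring
  rw [e1, e2, hanti b a h.symm, neg_mul, mul_assoc, hsq, mul_neg, ← mul_assoc, hsq]
  noncomm_ring

theorem cliff_mul_one_sub_of_ne (hanti : ∀ i j, i ≠ j → c i * c j = -(c j * c i)) {a b j : ι}
    (ha : j ≠ a) (hb : j ≠ b) : c j * (1 - c a * c b) = (1 - c a * c b) * c j := by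
  have e1 : c j * (1 - c a * c b) = c j - c j * c a * c b := by noncomm_ring
  have e2 : (1 - c a * c b) * c j = c j - c a * (c b * c j) := by noncomm_ring
  rw [e1, e2, hanti j a ha, hanti b j hb.symm]
  noncomm_ring

end Clifford

/-- Elements of a `ℂ`-algebra `R` satisfying the `S_n`-equivariant form of the relations of the
trigonometric double affine Hecke-Clifford algebra: `y_i` stands for `ε_i^∨` minus `u` times the
`i`-th Jucys-Murphy element. No relation between the `y_i` is imposed. -/
structure DunklSystem (n : ℕ) (u : ℂ) (R : Type*) [Ring R] [Algebra ℂ R] where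
  e : GroupAlg n →ₐ[ℂ] R
  s : Equiv.Perm (Fin n) →* R
  c : Fin n → R
  y : Fin n → R
  c_sq : ∀ i, c i * c i = 1
  c_anti : ∀ i j, i ≠ j → c i * c j = -(c j * c i)
  c_e : ∀ i p, c i * e p = e p * c i
  s_e : ∀ σ p, s σ * e p = e (permAlg σ p) * s σ
  s_c : ∀ σ i, s σ * c i = c (σ i) * s σ
  s_y : ∀ σ i, s σ * y i = y (σ i) * s σ
  c_y : ∀ i, c i * y i = -(y i * c i)
  c_y_ne : ∀ i j, i ≠ j → c j * y i = y i * c j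
  y_e : ∀ i p, y i * e p - e p * y i
    = u • ∑ k ∈ Finset.univ.erase i,
        e (demazure i k p) * ((1 - c i * c k) * s (Equiv.swap i k))

namespace DunklSystem

variable {n : ℕ} {u : ℂ} {R : Type*} [Ring R] [Algebra ℂ R] (D : DunklSystem n u R)

/-- The Clifford-twisted transposition `(1 - c_i c_k) s_{ik}`. -/
def g (i k : Fin n) : R := (1 - D.c i * D.c k) * D.s (Equiv.swap i k)

/-- The Jucys-Murphy element `∑_{k < i} (1 - c_i c_k) s_{ik}`. -/
def jm (i : Fin n) : R := ∑ k ∈ Finset.Iio i, D.g i k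

/-- The operator representing `ε_i^∨`. -/
def v (i : Fin n) : R := D.y i + u • D.jm i

/-- The element `e^{ε_i}`. -/
def z (i : Fin n) : R := D.e (ex (ep i))

theorem s_g (σ : Equiv.Perm (Fin n)) (i k : Fin n) :
    D.s σ * D.g i k = D.g (σ i) (σ k) * D.s σ := by
  have h1 : σ * Equiv.swap i k = Equiv.swap (σ i) (σ k) * σ := by
    rw [Equiv.swap_mul_eq_mul_swap]; simp
  unfold g
  calc D.s σ * ((1 - D.c i * D.c k) * D.s (Equiv.swap i k))
      = D.s σ * D.s (Equiv.swap i k) - D.s σ * D.c i * D.c k * D.s (Equiv.swap i k) := by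
        noncomm_ring
    _ = D.s σ * D.s (Equiv.swap i k)
          - D.c (σ i) * (D.s σ * D.c k) * D.s (Equiv.swap i k) := by rw [D.s_c]; noncomm_ring
    _ = (1 - D.c (σ i) * D.c (σ k)) * (D.s σ * D.s (Equiv.swap i k)) := by
        rw [D.s_c]; noncomm_ring
    _ = _ := by rw [← map_mul, h1, map_mul]; noncomm_ring

theorem c_g_fst (i k : Fin n) : D.c i * D.g i k = -(D.g i k * D.c i) := by
  have h1 : D.s (Equiv.swap i k) * D.c i = D.c k * D.s (Equiv.swap i k) := by
    rw [D.s_c, Equiv.swap_apply_left]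
  rw [g, ← mul_assoc, cliff_mul_one_sub_fst D.c_sq, mul_assoc, h1]; noncomm_ring

theorem c_g_snd {i k : Fin n} (h : i ≠ k) : D.c k * D.g i k = D.g i k * D.c k := by
  have h1 : D.s (Equiv.swap i k) * D.c k = D.c i * D.s (Equiv.swap i k) := by
    rw [D.s_c, Equiv.swap_apply_right]
  rw [g, ← mul_assoc, cliff_mul_one_sub_snd D.c_sq D.c_anti h, mul_assoc, mul_assoc, h1]

theorem c_mul_g_of_ne {i j k : Fin n} (hi : j ≠ i) (hk : j ≠ k) :
    D.c j * D.g i k = D.g i k * D.c j := by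
  have h1 : D.s (Equiv.swap i k) * D.c j = D.c j * D.s (Equiv.swap i k) := by
    rw [D.s_c, Equiv.swap_apply_of_ne_of_ne hi hk]
  rw [g, ← mul_assoc, cliff_mul_one_sub_of_ne D.c_anti hi hk, mul_assoc, mul_assoc, h1]

/-- `c_j` commutes with every twisted transposition that does not have `j` as its first index. -/
theorem c_g_of_ne_fst {i j k : Fin n} (hi : j ≠ i) :
    D.c j * D.g i k = D.g i k * D.c j := by
  by_cases hk : j = k
  · subst hk; exact D.c_g_snd hi.symm
  · exact D.c_mul_g_of_ne hi hk

/-- The twisted form of `s_{ab} s_{bl} = s_{al} s_{ab}`. -/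
theorem g_mul_g {a b l : Fin n} (hab : a ≠ b) (hal : a ≠ l) (hbl : b ≠ l) :
    D.g a b * D.g b l = D.g a l * D.g b a := by
  have h1 : D.g a b * D.g b l
      = (1 - D.c a * D.c b) * (1 - D.c a * D.c l)
        * (D.s (Equiv.swap a b) * D.s (Equiv.swap b l)) := by
    have := D.s_g (Equiv.swap a b) b l
    rw [Equiv.swap_apply_right, Equiv.swap_apply_of_ne_of_ne hal.symm hbl.symm] at this
    have e : Equiv.swap a l * Equiv.swap a b = Equiv.swap a b * Equiv.swap b l := by
      rw [Equiv.mul_swap_eq_swap_mul (Equiv.swap a b), Equiv.swap_apply_right,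
        Equiv.swap_apply_of_ne_of_ne hal.symm hbl.symm]
    rw [g, mul_assoc, this, g, mul_assoc, ← map_mul, e, map_mul, mul_assoc]
  have h2 : D.g a l * D.g b a
      = (1 - D.c a * D.c l) * (1 - D.c b * D.c l)
        * (D.s (Equiv.swap a b) * D.s (Equiv.swap b l)) := by
    have := D.s_g (Equiv.swap a l) b a
    rw [Equiv.swap_apply_left, Equiv.swap_apply_of_ne_of_ne hab.symm hbl] at this
    have e : Equiv.swap b l * Equiv.swap a l = Equiv.swap a b * Equiv.swap b l := by
      rw [Equiv.mul_swap_eq_swap_mul (Equiv.swap b l), Equiv.swap_apply_right,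
        Equiv.swap_apply_of_ne_of_ne hab hal]
    rw [g, mul_assoc, this, g, mul_assoc, ← map_mul, e, map_mul, mul_assoc]
  have h3 : (1 - D.c a * D.c b) * (1 - D.c a * D.c l)
      = (1 - D.c a * D.c l) * (1 - D.c b * D.c l) := by
    have e1 : (1 - D.c a * D.c b) * (1 - D.c a * D.c l)
      = 1 - D.c a * D.c b - D.c a * D.c l + D.c a * (D.c b * D.c a) * D.c l := by noncomm_ring
    have e2 : (1 - D.c a * D.c l) * (1 - D.c b * D.c l)
      = 1 - D.c a * D.c l - D.c b * D.c l + D.c a * (D.c l * D.c b) * D.c l := by noncomm_ring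
    have e3 : D.c a * (D.c b * D.c a) * D.c l = -(D.c b * D.c l) := by
      rw [D.c_anti b a hab.symm, mul_neg, ← mul_assoc, D.c_sq]; noncomm_ring
    have e4 : D.c a * (D.c l * D.c b) * D.c l = -(D.c a * D.c b) := by
      rw [D.c_anti l b hbl.symm, mul_neg, neg_mul, mul_assoc, mul_assoc, D.c_sq]; noncomm_ring
    rw [e1, e2, e3, e4]; abel
  rw [h1, h2, h3]

/-! ### Jucys-Murphy elements -/

theorem s_jm_of_image {i i' : Fin n} (σ : Equiv.Perm (Fin n)) (hi : σ i = i')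
    (hσ : ∀ k, k < i ↔ σ k < i') : D.s σ * D.jm i = D.jm i' * D.s σ := by
  rw [jm, jm, Finset.mul_sum, Finset.sum_mul]
  refine Finset.sum_equiv σ (by simpa using hσ) fun k _ => ?_
  rw [D.s_g, hi]

theorem c_jm_self (i : Fin n) : D.c i * D.jm i = -(D.jm i * D.c i) := by
  rw [jm, Finset.mul_sum, Finset.sum_mul, ← Finset.sum_neg_distrib]
  exact Finset.sum_congr rfl fun k _ => D.c_g_fst i k

theorem c_jm_of_ne {i j : Fin n} (h : j ≠ i) : D.c j * D.jm i = D.jm i * D.c j := by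
  rw [jm, Finset.mul_sum, Finset.sum_mul]
  exact Finset.sum_congr rfl fun k _ => D.c_g_of_ne_fst h

/-- The Jucys-Murphy elements commute: `jm b` commutes with the `c_a` for `a ≠ b` and with the
permutations of `{a | a < b}`. -/
theorem jm_comm {a b : Fin n} (h : a < b) : D.jm a * D.jm b = D.jm b * D.jm a := by
  rw [jm, Finset.sum_mul, Finset.mul_sum]
  refine Finset.sum_congr rfl fun k hk => ?_
  have hka : k < a := Finset.mem_Iio.mp hk
  have hkb : k < b := hka.trans h
  have hs : D.s (Equiv.swap a k) * D.jm b = D.jm b * D.s (Equiv.swap a k) := by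
    refine D.s_jm_of_image _ (Equiv.swap_apply_of_ne_of_ne h.ne' hkb.ne') fun m => ?_
    rcases eq_or_ne m a with rfl | hma
    · rw [Equiv.swap_apply_left]; simp [h, hkb]
    rcases eq_or_ne m k with rfl | hmk
    · rw [Equiv.swap_apply_right]; simp [h, hkb]
    · rw [Equiv.swap_apply_of_ne_of_ne hma hmk]
  have ha := D.c_jm_of_ne h.ne
  have hk' := D.c_jm_of_ne hkb.ne
  have hc : (1 - D.c a * D.c k) * D.jm b = D.jm b * (1 - D.c a * D.c k) := by
    rw [sub_mul, mul_assoc, hk', ← mul_assoc, ha]; noncomm_ring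
  rw [g, mul_assoc, hs, ← mul_assoc, hc, mul_assoc]

theorem s_mul_s_swap (i k : Fin n) : D.s (Equiv.swap i k) * D.s (Equiv.swap i k) = 1 := by
  rw [← map_mul, Equiv.swap_mul_self, map_one]

theorem jm_succ {i i' : Fin n} (h : (i' : ℕ) = i + 1) :
    D.jm i' * D.s (Equiv.swap i i') - D.s (Equiv.swap i i') * D.jm i = 1 - D.c i' * D.c i := by
  have hIio : Finset.Iio i' = insert i (Finset.Iio i) := by
    ext k; simp only [Finset.mem_Iio, Finset.mem_insert, Fin.lt_def, Fin.ext_iff]; omega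
  have hg : D.g i' i * D.s (Equiv.swap i i') = 1 - D.c i' * D.c i := by
    rw [g, Equiv.swap_comm i' i, mul_assoc, s_mul_s_swap, mul_one]
  have hrest : D.s (Equiv.swap i i') * D.jm i
      = (∑ k ∈ Finset.Iio i, D.g i' k) * D.s (Equiv.swap i i') := by
    rw [jm, Finset.mul_sum, Finset.sum_mul]
    refine Finset.sum_congr rfl fun k hk => ?_
    have hk' : (k : ℕ) < i := Fin.lt_def.mp (Finset.mem_Iio.mp hk)
    have h1 : k ≠ i := fun e => by rw [e] at hk'; omega
    have h2 : k ≠ i' := fun e => by rw [e] at hk'; omega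
    rw [D.s_g, Equiv.swap_apply_left, Equiv.swap_apply_of_ne_of_ne h1 h2]
  rw [hrest, ← hg, jm, hIio, Finset.sum_insert (by simp)]
  noncomm_ring

/-! ### The relations satisfied by `v` -/

theorem c_v_self (i : Fin n) : D.c i * D.v i = -(D.v i * D.c i) := by
  rw [v, mul_add, add_mul, D.c_y, mul_smul_comm, smul_mul_assoc, D.c_jm_self, smul_neg, neg_add]

theorem c_v_of_ne {i j : Fin n} (h : i ≠ j) : D.c j * D.v i = D.v i * D.c j := by
  rw [v, mul_add, add_mul, D.c_y_ne i j h, mul_smul_comm, smul_mul_assoc, D.c_jm_of_ne h.symm]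

theorem v_simple {i i' : Fin n} (h : (i' : ℕ) = i + 1) :
    D.v i' * D.s (Equiv.swap i i') - D.s (Equiv.swap i i') * D.v i
      = u • (1 - D.c i' * D.c i) := by
  rw [v, v, add_mul, mul_add, D.s_y, Equiv.swap_apply_left, smul_mul_assoc, mul_smul_comm,
    add_sub_add_left_eq_sub, ← smul_sub, D.jm_succ h]

theorem v_simple_of_ne {i i' j : Fin n} (h : (i' : ℕ) = i + 1) (hi : j ≠ i) (hi' : j ≠ i') :
    D.v j * D.s (Equiv.swap i i') = D.s (Equiv.swap i i') * D.v j := by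
  have hj : Equiv.swap i i' j = j := Equiv.swap_apply_of_ne_of_ne hi hi'
  have hjm : D.s (Equiv.swap i i') * D.jm j = D.jm j * D.s (Equiv.swap i i') := by
    refine D.s_jm_of_image _ hj fun m => ?_
    have h1 : (j : ℕ) ≠ i := fun e => hi (Fin.ext e)
    have h2 : (j : ℕ) ≠ i' := fun e => hi' (Fin.ext e)
    rcases eq_or_ne m i with rfl | hmi
    · rw [Equiv.swap_apply_left, Fin.lt_def, Fin.lt_def]; omega
    rcases eq_or_ne m i' with rfl | hmi'
    · rw [Equiv.swap_apply_right, Fin.lt_def, Fin.lt_def]; omega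
    · rw [Equiv.swap_apply_of_ne_of_ne hmi hmi']
  rw [v, add_mul, mul_add, D.s_y, hj, smul_mul_assoc, mul_smul_comm, hjm]

theorem g_e (i k : Fin n) (p : GroupAlg n) :
    D.g i k * D.e p = D.e (permAlg (Equiv.swap i k) p) * D.g i k := by
  have h : ∀ q, (1 - D.c i * D.c k) * D.e q = D.e q * (1 - D.c i * D.c k) := fun q => by
    rw [sub_mul, mul_assoc, D.c_e, ← mul_assoc, D.c_e]; noncomm_ring
  rw [g, mul_assoc, D.s_e, ← mul_assoc, h, mul_assoc]

theorem v_e (i : Fin n) (η : Weight n) :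
    D.v i * D.e (ex η) - D.e (ex η) * D.v i
      = u • ∑ k ∈ Finset.univ.erase i,
          (sg i k : ℂ) • (D.e (divDiff i k η) * (1 - D.c i * D.c k)
            * D.s (Equiv.swap k i)) := by
  have hjm : D.jm i * D.e (ex η) - D.e (ex η) * D.jm i
      = ∑ k ∈ Finset.univ.erase i, if k < i then
          D.e (ex (permWeight (Equiv.swap i k) η) - ex η) * D.g i k else 0 := by
    have hI : (Finset.univ.erase i).filter (· < i) = Finset.Iio i := by
      ext k; simp +contextual [ne_of_lt]
    rw [← Finset.sum_filter, hI, jm, Finset.sum_mul, Finset.mul_sum, ← Finset.sum_sub_distrib]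
    refine Finset.sum_congr rfl fun k _ => ?_
    rw [D.g_e, permAlg_ex, map_sub, sub_mul]
  rw [v, add_mul, mul_add, add_sub_add_comm, D.y_e, smul_mul_assoc, mul_smul_comm, ← smul_sub,
    ← smul_add, hjm, ← Finset.sum_add_distrib]
  congr 1
  refine Finset.sum_congr rfl fun k _ => ?_
  rw [Equiv.swap_comm k i, demazure_ex, demazureEx, mul_assoc, map_add, map_smul, ← g]
  split_ifs
  · rw [map_sub, map_sub, add_mul, smul_mul_assoc]; noncomm_ring
  · simp

/-! ### The curvature of the `y` -/

/-- The equivariant expression `[y_a, y_b] + u [y_a, (1 - c_b c_a) s_{ab}]`; for `a < b` it is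
the commutator of `v a` and `v b`. -/
def curv (a b : Fin n) : R :=
  (D.y a * D.y b - D.y b * D.y a) + u • (D.y a * D.g b a - D.g b a * D.y a)

theorem s_curv (σ : Equiv.Perm (Fin n)) (a b : Fin n) :
    D.s σ * D.curv a b = D.curv (σ a) (σ b) * D.s σ := by
  have hyy : ∀ a b, D.s σ * (D.y a * D.y b) = D.y (σ a) * D.y (σ b) * D.s σ := fun a b => by
    rw [← mul_assoc, D.s_y, mul_assoc, D.s_y, mul_assoc]
  have hyg : D.s σ * (D.y a * D.g b a) = D.y (σ a) * D.g (σ b) (σ a) * D.s σ := by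
    rw [← mul_assoc, D.s_y, mul_assoc, D.s_g, mul_assoc]
  have hgy : D.s σ * (D.g b a * D.y a) = D.g (σ b) (σ a) * D.y (σ a) * D.s σ := by
    rw [← mul_assoc, D.s_g, mul_assoc, D.s_y, mul_assoc]
  rw [curv, curv, mul_add, mul_sub, hyy, hyy, mul_smul_comm, mul_sub, hyg, hgy, add_mul,
    smul_mul_assoc, sub_mul, sub_mul]

theorem y_g_of_ne {i j k : Fin n} (hj : i ≠ j) (hk : i ≠ k) :
    D.y i * D.g j k = D.g j k * D.y i := by
  have h1 : D.s (Equiv.swap j k) * D.y i = D.y i * D.s (Equiv.swap j k) := by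
    rw [D.s_y, Equiv.swap_apply_of_ne_of_ne hj hk]
  rw [g, mul_assoc, h1, ← mul_assoc, ← mul_assoc, mul_sub, sub_mul, ← mul_assoc,
    ← D.c_y_ne i j hj, mul_assoc (D.c j), ← D.c_y_ne i k hk]
  noncomm_ring

theorem y_g_add_y_g {a b : Fin n} (h : a ≠ b) :
    (D.y a * D.g b a - D.g b a * D.y a) + (D.y b * D.g a b - D.g a b * D.y b) = 0 := by
  -- moving `y_a` through `g_{ba}` turns it into `y_b` and exchanges the two Clifford indices
  have key : ∀ a b : Fin n, a ≠ b → D.y a * D.g b a = D.g a b * D.y b := fun a b h => by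
    have h1 : D.s (Equiv.swap a b) * D.y b = D.y a * D.s (Equiv.swap a b) := by
      rw [D.s_y, Equiv.swap_apply_right]
    have h2 : D.c a * D.c b * D.y a = D.y a * D.c b * D.c a := by
      rw [mul_assoc, D.c_y_ne a b h, ← mul_assoc, D.c_y, neg_mul, mul_assoc, D.c_anti a b h,
        mul_neg, neg_neg, mul_assoc]
    rw [g, g, mul_assoc, h1, Equiv.swap_comm b a, ← mul_assoc, ← mul_assoc]
    congr 1
    rw [sub_mul, h2]; noncomm_ring
  rw [key a b h, key b a h.symm]; abel

theorem curv_antisymm {a b : Fin n} (h : a ≠ b) : D.curv b a = -D.curv a b := by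
  have h1 := eq_neg_of_add_eq_zero_right (D.y_g_add_y_g h)
  rw [curv, curv, h1, smul_neg]; abel

theorem v_commutator {a b : Fin n} (h : a < b) :
    D.v a * D.v b - D.v b * D.v a = D.curv a b := by
  have h1 : D.y a * D.jm b - D.jm b * D.y a = D.y a * D.g b a - D.g b a * D.y a := by
    rw [jm, Finset.mul_sum, Finset.sum_mul, ← Finset.sum_sub_distrib]
    refine Finset.sum_eq_single a (fun k _ hk => ?_) (by simp [h])
    rw [D.y_g_of_ne h.ne hk.symm, sub_self]
  have h2 : D.y b * D.jm a = D.jm a * D.y b := by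
    rw [jm, Finset.mul_sum, Finset.sum_mul]
    refine Finset.sum_congr rfl fun k hk => D.y_g_of_ne h.ne' ?_
    exact ((Finset.mem_Iio.mp hk).trans h).ne'
  rw [curv, ← h1]
  simp only [v, mul_add, add_mul, mul_smul_comm, smul_mul_assoc, D.jm_comm h, h2, smul_sub,
    smul_add]
  abel

theorem g_z (i k : Fin n) (l : Fin n) : D.g i k * D.z l = D.z (Equiv.swap i k l) * D.g i k := by
  rw [z, D.g_e, permAlg_ex, permWeight_ep, z]

theorem y_z_of_ne {i l : Fin n} (h : l ≠ i) :
    D.y i * D.z l = D.z l * D.y i - u • (D.z i * D.g i l) := by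
  rw [sub_eq_add_neg, ← sub_eq_iff_eq_add', z, D.y_e, ← smul_neg]
  congr 1
  rw [Finset.sum_eq_single l]
  · rw [demazure_ep_other h, map_neg, neg_mul]; rfl
  · intro k hk hkl
    rw [demazure_ep_of_ne (Finset.ne_of_mem_erase hk) h hkl.symm, map_zero, zero_mul]
  · simp [h]

theorem y_z_self (i : Fin n) :
    D.y i * D.z i
      = D.z i * D.y i + u • (D.z i * ∑ k ∈ Finset.univ.erase i, D.g i k) := by
  rw [← sub_eq_iff_eq_add', z, D.y_e, Finset.mul_sum]
  congr 1
  refine Finset.sum_congr rfl fun k hk => ?_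
  rw [demazure_ep_self (Finset.ne_of_mem_erase hk)]; rfl

/-- The curvature commutes with `e^{ε_l}` when `l` is not one of its indices, by `g_mul_g`. -/
theorem curv_z_of_ne {a b l : Fin n} (hab : a ≠ b) (hal : a ≠ l) (hbl : b ≠ l) :
    D.curv a b * D.z l = D.z l * D.curv a b := by
  have ga : D.g b a * D.z a = D.z b * D.g b a := by rw [g_z, Equiv.swap_apply_right]
  have gl : D.g b a * D.z l = D.z l * D.g b a := by
    rw [g_z, Equiv.swap_apply_of_ne_of_ne hbl.symm hal.symm]
  have yal := D.y_z_of_ne hal.symm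
  have ybl := D.y_z_of_ne hbl.symm
  have yab := D.y_z_of_ne hab.symm
  have yba := D.y_z_of_ne hab
  have ca := D.y_g_of_ne hab hal
  have cb := D.y_g_of_ne hab.symm hbl
  have gg := D.g_mul_g hab hal hbl
  have t1 : D.y a * D.y b * D.z l = D.z l * D.y a * D.y b - u • (D.z a * D.g a l * D.y b)
      - u • (D.z b * D.g b l * D.y a) + (u * u) • (D.z a * (D.g a b * D.g b l)) := by
    rw [mul_assoc, ybl, mul_sub, ← mul_assoc, yal, mul_smul_comm, ← mul_assoc (D.y a), yab,
      sub_mul _ _ (D.g b l), mul_assoc (D.z b) (D.y a), ca]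
    simp only [sub_mul, smul_sub, smul_mul_assoc, mul_assoc, smul_smul]
    abel
  have t2 : D.y b * D.y a * D.z l = D.z l * D.y b * D.y a - u • (D.z b * D.g b l * D.y a)
      - u • (D.z a * D.g a l * D.y b) + (u * u) • (D.z b * (D.g b a * D.g a l)) := by
    rw [mul_assoc, yal, mul_sub, ← mul_assoc, ybl, mul_smul_comm, ← mul_assoc (D.y b), yba,
      sub_mul _ _ (D.g a l), mul_assoc (D.z a) (D.y b), cb]
    simp only [sub_mul, smul_sub, smul_mul_assoc, mul_assoc, smul_smul]
    abel
  have t3 : D.y a * D.g b a * D.z l = D.z l * D.y a * D.g b a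
      - u • (D.z a * (D.g a l * D.g b a)) := by
    rw [mul_assoc, gl, ← mul_assoc, yal, sub_mul, smul_mul_assoc, mul_assoc (D.z a)]
  have t4 : D.g b a * D.y a * D.z l = D.z l * D.g b a * D.y a
      - u • (D.z b * (D.g b a * D.g a l)) := by
    rw [mul_assoc, yal, mul_sub, ← mul_assoc, gl, mul_smul_comm, ← mul_assoc _ (D.z a), ga,
      mul_assoc (D.z b)]
  simp only [curv, add_mul, sub_mul, smul_mul_assoc, t1, t2, t3, t4, gg, mul_add, mul_sub,
    mul_smul_comm, smul_sub, smul_smul, mul_assoc]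
  abel

/-- The curvature commutes with `e^{ε_a}` for its first index `a`: the terms quadratic in `u` cancel
in pairs, and the linear ones in pairs or by `y_g_add_y_g`. -/
theorem curv_z_fst {a b : Fin n} (hab : a ≠ b) :
    D.curv a b * D.z a = D.z a * D.curv a b := by
  have ga : D.g b a * D.z a = D.z b * D.g b a := by rw [g_z, Equiv.swap_apply_right]
  have yab := D.y_z_of_ne hab.symm
  have yba := D.y_z_of_ne hab
  have yaa := D.y_z_self a
  have hg := D.y_g_add_y_g hab
  set G := ∑ k ∈ Finset.univ.erase a, D.g a k
  have hG : D.y b * G - G * D.y b = D.y b * D.g a b - D.g a b * D.y b := by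
    rw [Finset.mul_sum, Finset.sum_mul, ← Finset.sum_sub_distrib]
    refine Finset.sum_eq_single b (fun k _ hk => ?_) (by simp [hab.symm])
    rw [D.y_g_of_ne hab.symm hk.symm, sub_self]
  have hG' : D.y b * G = G * D.y b + (D.y b * D.g a b - D.g a b * D.y b) := by
    rw [← hG]; abel
  have hg' : D.y b * D.g a b - D.g a b * D.y b = D.g b a * D.y a - D.y a * D.g b a := by
    rw [eq_neg_of_add_eq_zero_right hg]; abel
  rw [hg'] at hG'
  have t1 : D.y a * D.y b * D.z a = D.z a * (D.y a * D.y b) + u • (D.z a * (G * D.y b))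
      - u • (D.z b * (D.y a * D.g b a)) + (u * u) • (D.z a * (D.g a b * D.g b a)) := by
    rw [mul_assoc, yba, mul_sub, ← mul_assoc, yaa, mul_smul_comm, ← mul_assoc (D.y a), yab]
    simp only [sub_mul, add_mul, smul_sub, smul_mul_assoc, mul_assoc, smul_smul]
    abel
  have t2 : D.y b * D.y a * D.z a = D.z a * (D.y b * D.y a) - u • (D.z b * (D.g b a * D.y a))
      + u • (D.z a * (G * D.y b)) + u • (D.z a * (D.g b a * D.y a))
      - u • (D.z a * (D.y a * D.g b a))
      - (u * u) • (D.z b * (D.g b a * G)) := by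
    rw [mul_assoc, yaa, mul_add, ← mul_assoc, yba, mul_smul_comm, ← mul_assoc (D.y b), yba,
      sub_mul _ _ G, mul_assoc (D.z a) _ G, hG']
    simp only [sub_mul, mul_add, mul_sub, smul_add, smul_sub, smul_mul_assoc, mul_assoc, smul_smul]
    abel
  have t3 : D.y a * D.g b a * D.z a = D.z b * (D.y a * D.g b a)
      - u • (D.z a * (D.g a b * D.g b a)) := by
    rw [mul_assoc, ga, ← mul_assoc, yab, sub_mul, smul_mul_assoc, mul_assoc, mul_assoc]
  have t4 : D.g b a * D.y a * D.z a = D.z b * (D.g b a * D.y a)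
      + u • (D.z b * (D.g b a * G)) := by
    rw [mul_assoc, yaa, mul_add, ← mul_assoc, ga, mul_smul_comm, ← mul_assoc _ (D.z a), ga,
      mul_assoc (D.z b), mul_assoc (D.z b)]
  simp only [curv, add_mul, sub_mul, smul_mul_assoc, t1, t2, t3, t4, mul_add, mul_sub,
    mul_smul_comm, smul_sub, smul_add, smul_smul]
  abel

theorem curv_z {a b : Fin n} (hab : a ≠ b) (l : Fin n) :
    D.curv a b * D.z l = D.z l * D.curv a b := by
  rcases eq_or_ne a l with rfl | hal
  · exact D.curv_z_fst hab
  rcases eq_or_ne b l with rfl | hbl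
  · have h := D.curv_z_fst hab.symm
    rw [D.curv_antisymm hab] at h
    simpa using h
  · exact D.curv_z_of_ne hab hal hbl

/-! ### The homomorphism attached to an equivariant system -/

theorem z_mul_inv (l : Fin n) : D.z l * D.e (ex (-ep l)) = 1 := by
  rw [z, ← map_mul, ex_mul, add_neg_cancel, ← map_one D.e]; rfl

theorem inv_mul_z (l : Fin n) : D.e (ex (-ep l)) * D.z l = 1 := by
  rw [z, ← map_mul, ex_mul, neg_add_cancel, ← map_one D.e]; rfl

theorem curv_e {a b : Fin n} (hab : a ≠ b) (p : GroupAlg n) :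
    D.curv a b * D.e p = D.e p * D.curv a b :=
  intertwine_groupAlg D.e _ (AlgHom.id ℂ _) (D.curv_z hab) p

/-- The images of the generators under the representation attached to an equivariant system. -/
def genMap : Gen n → R
  | Gen.expPos i => D.z i
  | Gen.expNeg i => D.e (ex (-ep i))
  | Gen.coroot i => D.v i
  | Gen.cliff i => D.c i
  | Gen.perm σ => D.s σ

theorem lift_expWord (η : Weight n) :
    FreeAlgebra.lift ℂ D.genMap (expWord η) = D.e (ex η) := by
  rw [← expWord_prod, expWord, map_list_prod, map_list_prod, List.map_map, List.map_map]
  congr 1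
  refine List.map_congr_left fun i _ => ?_
  simp only [Function.comp_apply, map_mul, map_pow, FreeAlgebra.lift_ι_apply, genMap, z]

theorem lift_expLift (f : GroupAlg n) :
    FreeAlgebra.lift ℂ D.genMap (expLift f) = D.e f := by
  rw [expLift, Finsupp.sum, map_sum]
  conv_rhs => rw [← AddMonoidAlgebra.sum_coeff_single f, Finsupp.sum, map_sum]
  refine Finset.sum_congr rfl fun η _ => ?_
  rw [map_smul, D.lift_expWord, ← map_smul]
  simp [ex]

theorem v_comm (hD : ∀ a b, a < b → D.curv a b = 0) (a b : Fin n) :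
    D.v a * D.v b = D.v b * D.v a := by
  rcases lt_trichotomy a b with h | rfl | h
  · rw [← sub_eq_zero, D.v_commutator h, hD a b h]
  · rfl
  · rw [eq_comm, ← sub_eq_zero, D.v_commutator h, hD b a h]

theorem z_comm (i j : Fin n) : D.z i * D.z j = D.z j * D.z i := by
  rw [z, z, ← map_mul, mul_comm, map_mul]

/-- An equivariant system with vanishing curvature is a homomorphism from the trigonometric double
affine Hecke-Clifford algebra. -/
def hom (hD : ∀ a b, a < b → D.curv a b = 0) : TrigDaHCa n u →ₐ[ℂ] R :=
  RingQuot.liftAlgHom ℂ ⟨FreeAlgebra.lift ℂ D.genMap, fun x y h => by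
    cases h with
    | perm_one => simp [genMap]
    | perm_mul σ τ => simp [genMap]
    | cliff_sq i => simpa [genMap] using D.c_sq i
    | cliff_anti i j h => simpa [genMap] using D.c_anti i j h
    | exp_mul_inv i => simpa [genMap] using D.z_mul_inv i
    | exp_inv_mul i => simpa [genMap] using D.inv_mul_z i
    | exp_comm i j => simpa [genMap] using D.z_comm i j
    | coroot_comm i j => simpa [genMap] using D.v_comm hD i j
    | cliff_exp i j => simpa [genMap, z] using D.c_e j (ex (ep i))
    | perm_exp σ i =>
      have := D.s_e σ (ex (ep i))
      rw [permAlg_ex, permWeight_ep] at this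
      simpa [genMap, z] using this
    | perm_cliff σ i => simpa [genMap] using D.s_c σ i
    | cliff_coroot i => simpa [genMap] using D.c_v_self i
    | cliff_coroot_ne i j h => simpa [genMap] using D.c_v_of_ne h
    | coroot_simple i i' h => simpa [genMap] using D.v_simple h
    | coroot_simple_ne i i' j h hi hi' => simpa [genMap] using D.v_simple_of_ne h hi hi'
    | coroot_exp i η =>
      have := D.v_e i η
      simpa only [map_sub, map_mul, D.lift_expWord, map_smul, map_sum, D.lift_expLift, map_one,
        FreeAlgebra.lift_ι_apply, genMap] using this⟩

variable (hD : ∀ a b, a < b → D.curv a b = 0)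

theorem hom_mk (x : Free n) : D.hom hD (TrigDaHCa.mk n u x) = FreeAlgebra.lift ℂ D.genMap x :=
  RingQuot.liftAlgHom_mkAlgHom_apply ℂ _ _ _

theorem hom_expHom (p : GroupAlg n) : D.hom hD (expHom u p) = D.e p := by
  rw [← mk_expLift, hom_mk, lift_expLift]

theorem hom_gS (σ : Equiv.Perm (Fin n)) : D.hom hD (gS u σ) = D.s σ := by
  rw [gS, hom_mk, FreeAlgebra.lift_ι_apply]; rfl

theorem hom_gC (i : Fin n) : D.hom hD (gC u i) = D.c i := by
  rw [gC, hom_mk, FreeAlgebra.lift_ι_apply]; rfl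

theorem hom_gV (i : Fin n) : D.hom hD (gV u i) = D.v i := by
  rw [gV, hom_mk, FreeAlgebra.lift_ι_apply]; rfl

end DunklSystem

/-! ### Operators on the coefficients -/

section Coeff

variable {n : ℕ} {A : Type*} [AddCommGroup A] [Module ℂ A]

/-- Operators on `ℂ[P]`, acting on the first factor of `ℂ[P] ⊗ A`. -/
def opL : Module.End ℂ (GroupAlg n) →ₐ[ℂ] Module.End ℂ (GroupAlg n ⊗[ℂ] A) :=
  Module.End.rTensorAlgHom ℂ (GroupAlg n) A

/-- Operators on `A`, acting on the second factor of `ℂ[P] ⊗ A`. -/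
def opR : Module.End ℂ A →ₐ[ℂ] Module.End ℂ (GroupAlg n ⊗[ℂ] A) :=
  Module.End.lTensorAlgHom ℂ A (GroupAlg n)

theorem opL_tmul (T : Module.End ℂ (GroupAlg n)) (p : GroupAlg n) (a : A) :
    opL T (p ⊗ₜ a) = T p ⊗ₜ a := rfl

theorem opR_tmul (T : Module.End ℂ A) (p : GroupAlg n) (a : A) :
    opR T (p ⊗ₜ a) = p ⊗ₜ T a := rfl

theorem opL_opR (S : Module.End ℂ (GroupAlg n)) (T : Module.End ℂ A) (b : GroupAlg n ⊗[ℂ] A) :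
    opL S (opR T b) = opR T (opL S b) := by
  induction b using TensorProduct.induction_on with
  | zero => simp
  | add x y hx hy => simp only [map_add, hx, hy]
  | tmul p a => rfl

theorem opR_smul (T : Module.End ℂ A) (p : GroupAlg n) (b : GroupAlg n ⊗[ℂ] A) :
    opR T (p • b) = p • opR T b := by
  induction b using TensorProduct.induction_on with
  | zero => simp
  | add x y hx hy => simp only [map_add, smul_add, hx, hy]
  | tmul q a => rfl

theorem opL_permAlg_smul (σ : Equiv.Perm (Fin n)) (p : GroupAlg n) (b : GroupAlg n ⊗[ℂ] A) :
    opL (permAlg σ).toLinearMap (p • b) = permAlg σ p • opL (permAlg σ).toLinearMap b := by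
  induction b using TensorProduct.induction_on with
  | zero => simp
  | add x y hx hy => simp only [map_add, smul_add, hx, hy]
  | tmul q a =>
    rw [TensorProduct.smul_tmul', opL_tmul, opL_tmul, TensorProduct.smul_tmul', smul_eq_mul,
      smul_eq_mul, AlgHom.toLinearMap_apply, map_mul]; rfl

theorem opL_demazure_smul {i k : Fin n} (h : k ≠ i) (p : GroupAlg n) (b : GroupAlg n ⊗[ℂ] A) :
    opL (demazure i k) (p • b)
      = demazure i k p • opL (permAlg (Equiv.swap i k)).toLinearMap b
        + p • opL (demazure i k) b := by
  induction b using TensorProduct.induction_on with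
  | zero => simp
  | add x y hx hy => simp only [map_add, smul_add, hx, hy]; abel
  | tmul q a =>
    simp only [TensorProduct.smul_tmul', opL_tmul, smul_eq_mul, AlgHom.toLinearMap_apply,
      demazure_mul h, TensorProduct.add_tmul]

theorem permAlg_mul_end (σ τ : Equiv.Perm (Fin n)) :
    ((permAlg (σ * τ)).toLinearMap : Module.End ℂ (GroupAlg n))
      = (permAlg σ).toLinearMap * (permAlg τ).toLinearMap :=
  LinearMap.ext fun p => permAlg_mul σ τ p

theorem permAlg_one_end : ((permAlg 1).toLinearMap : Module.End ℂ (GroupAlg n)) = 1 :=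
  LinearMap.ext fun p => permAlg_one p

theorem permAlg_demazure_end (σ : Equiv.Perm (Fin n)) {i k : Fin n} (h : k ≠ i) :
    ((permAlg σ).toLinearMap : Module.End ℂ (GroupAlg n)) * demazure i k
      = demazure (σ i) (σ k) * (permAlg σ).toLinearMap :=
  LinearMap.ext fun p => permAlg_demazure σ h p

end Coeff

/-- A module over the algebra generated by the Clifford algebra and commuting elements
`v_i = ε_i^∨` such that `v_i` anticommutes with `c_i` and commutes with the other `c_j`. -/
structure CliffCorootModule (n : ℕ) (A : Type*) [AddCommGroup A] [Module ℂ A] where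
  c : Fin n → Module.End ℂ A
  v : Fin n → Module.End ℂ A
  c_sq : ∀ i, c i * c i = 1
  c_anti : ∀ i j, i ≠ j → c i * c j = -(c j * c i)
  c_v_self : ∀ i, c i * v i = -(v i * c i)
  c_v_of_ne : ∀ i j, i ≠ j → c j * v i = v i * c j
  v_comm : ∀ i j, v i * v j = v j * v i

/-! ### Induced modules -/

section Induced

variable (n : ℕ) (A : Type*) [AddCommGroup A] [Module ℂ A]

/-- The space of the module induced from `A`; the function `f` stands for the element
`∑_w f(w) · w` of `ℂ[P] ⊗ ℂ S_n ⊗ A`. -/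
abbrev Reg : Type _ := Equiv.Perm (Fin n) → GroupAlg n ⊗[ℂ] A

variable {n A} (X : CliffCorootModule n A)

/-- The action of `S_n` on the induced module. -/
def regS : Equiv.Perm (Fin n) →* Module.End ℂ (Reg n A) where
  toFun σ := LinearMap.pi fun w =>
    opL (permAlg σ).toLinearMap ∘ₗ LinearMap.proj (σ⁻¹ * w)
  map_one' := by
    refine LinearMap.ext fun f => funext fun w => ?_
    simp [permAlg_one_end]
  map_mul' σ τ := by
    refine LinearMap.ext fun f => funext fun w => ?_
    simp [permAlg_mul_end, mul_assoc]

/-- The action of `c_i` on the induced module. -/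
def regC (i : Fin n) : Module.End ℂ (Reg n A) :=
  LinearMap.pi fun w => opR (X.c (w⁻¹ i)) ∘ₗ LinearMap.proj w

/-- The contribution of the value at `s_{ik} w` to the value at `w` in the equivariant operator
`y_i`, up to the factor `u`. The Demazure operator comes from moving `ε_i^∨` past
`ℂ[P]`, the truncation from moving it past `w`. -/
def regK (i k : Fin n) (w : Equiv.Perm (Fin n)) : Module.End ℂ (GroupAlg n ⊗[ℂ] A) :=
  (opL (demazure i k) - if w⁻¹ i < w⁻¹ k then 1 else 0)
    * opR (1 - X.c (w⁻¹ i) * X.c (w⁻¹ k))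

/-- The action of `ε_i^∨` minus `u` times the `i`-th Jucys-Murphy element. -/
def regY (u : ℂ) (i : Fin n) : Module.End ℂ (Reg n A) :=
  LinearMap.pi fun w => opR (X.v (w⁻¹ i)) ∘ₗ LinearMap.proj w
    + u • ∑ k ∈ Finset.univ.erase i, regK X i k w ∘ₗ LinearMap.proj (Equiv.swap i k * w)

theorem regS_apply (σ : Equiv.Perm (Fin n)) (f : Reg n A) (w : Equiv.Perm (Fin n)) :
    regS σ f w = opL (permAlg σ).toLinearMap (f (σ⁻¹ * w)) := rfl

theorem regC_apply (i : Fin n) (f : Reg n A) (w : Equiv.Perm (Fin n)) :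
    regC X i f w = opR (X.c (w⁻¹ i)) (f w) := rfl

theorem regY_apply (u : ℂ) (i : Fin n) (f : Reg n A) (w : Equiv.Perm (Fin n)) :
    regY X u i f w = opR (X.v (w⁻¹ i)) (f w)
      + u • ∑ k ∈ Finset.univ.erase i, regK X i k w (f (Equiv.swap i k * w)) := by
  rw [regY, LinearMap.pi_apply, LinearMap.add_apply, LinearMap.smul_apply, LinearMap.sum_apply]
  rfl

theorem regK_apply (i k : Fin n) (w : Equiv.Perm (Fin n)) (b : GroupAlg n ⊗[ℂ] A) :
    regK X i k w b
      = opL (demazure i k) (opR (1 - X.c (w⁻¹ i) * X.c (w⁻¹ k)) b)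
        - if w⁻¹ i < w⁻¹ k then opR (1 - X.c (w⁻¹ i) * X.c (w⁻¹ k)) b else 0 := by
  rw [regK, Module.End.mul_apply, LinearMap.sub_apply]
  split_ifs <;> rfl

theorem regK_equivariant (σ : Equiv.Perm (Fin n)) {i k : Fin n} (h : k ≠ i)
    (w : Equiv.Perm (Fin n)) (b : GroupAlg n ⊗[ℂ] A) :
    opL (permAlg σ).toLinearMap (regK X i k (σ⁻¹ * w) b)
      = regK X (σ i) (σ k) w (opL (permAlg σ).toLinearMap b) := by
  have hd : ∀ b : GroupAlg n ⊗[ℂ] A, opL (permAlg σ).toLinearMap (opL (demazure i k) b)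
      = opL (demazure (σ i) (σ k)) (opL (permAlg σ).toLinearMap b) := fun b => by
    rw [← Module.End.mul_apply, ← map_mul, permAlg_demazure_end σ h, map_mul,
      Module.End.mul_apply]
  have hw : ∀ j, (σ⁻¹ * w)⁻¹ j = w⁻¹ (σ j) := fun j => by simp
  rw [regK_apply, regK_apply, hw, hw, map_sub, hd, opL_opR]
  split_ifs
  · rw [opL_opR, opL_opR]
  · rw [map_zero, opL_opR]

theorem regK_smul {i k : Fin n} (h : k ≠ i) (w : Equiv.Perm (Fin n)) (p : GroupAlg n)
    (b : GroupAlg n ⊗[ℂ] A) :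
    regK X i k w (p • b) = p • regK X i k w b
      + demazure i k p • opR (1 - X.c (w⁻¹ i) * X.c (w⁻¹ k))
          (opL (permAlg (Equiv.swap i k)).toLinearMap b) := by
  rw [regK_apply, regK_apply, opR_smul, opL_demazure_smul h, opL_opR _ _ b, opL_opR _ _ b,
    smul_sub]
  split_ifs
  · abel
  · rw [smul_zero]; abel

theorem opR_regK {i k : Fin n} (w : Equiv.Perm (Fin n)) {S T : Module.End ℂ A}
    (h : S * (1 - X.c (w⁻¹ i) * X.c (w⁻¹ k))
      = (1 - X.c (w⁻¹ i) * X.c (w⁻¹ k)) * T) (b : GroupAlg n ⊗[ℂ] A) :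
    opR S (regK X i k w b) = regK X i k w (opR T b) := by
  have h' : ∀ b : GroupAlg n ⊗[ℂ] A, opR S (opR (1 - X.c (w⁻¹ i) * X.c (w⁻¹ k)) b)
      = opR (1 - X.c (w⁻¹ i) * X.c (w⁻¹ k)) (opR T b) := fun b => by
    rw [← Module.End.mul_apply, ← map_mul, h, map_mul, Module.End.mul_apply]
  rw [regK_apply, regK_apply, map_sub, ← opL_opR, h']
  split_ifs
  · rw [h']
  · rw [map_zero]

theorem regS_regY (u : ℂ) (σ : Equiv.Perm (Fin n)) (i : Fin n) :
    regS σ * regY X u i = regY X u (σ i) * regS σ := by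
  refine LinearMap.ext fun f => funext fun w => ?_
  rw [Module.End.mul_apply, Module.End.mul_apply, regS_apply, regY_apply, regY_apply, regS_apply,
    map_add, map_smul, map_sum, opL_opR]
  congr 2
  refine Finset.sum_equiv σ (by simp) fun k hk => ?_
  have h1 : Equiv.swap i k * (σ⁻¹ * w) = σ⁻¹ * (Equiv.swap (σ i) (σ k) * w) := by
    rw [← mul_assoc, ← mul_assoc, Equiv.mul_swap_eq_swap_mul]; simp
  rw [regS_apply, regK_equivariant X σ (Finset.ne_of_mem_erase hk), h1]

theorem regC_regY_self (u : ℂ) (i : Fin n) : regC X i * regY X u i = -(regY X u i * regC X i) := by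
  refine LinearMap.ext fun f => funext fun w => ?_
  rw [LinearMap.neg_apply, Pi.neg_apply, Module.End.mul_apply, Module.End.mul_apply, regC_apply,
    regY_apply, regY_apply, regC_apply, map_add, map_smul, map_sum, neg_add]
  have hneg : ∀ x : GroupAlg n ⊗[ℂ] A, -(u • x) = u • -x := fun x => (smul_neg u x).symm
  rw [hneg, ← Finset.sum_neg_distrib]
  congr 1
  · rw [← Module.End.mul_apply, ← map_mul, X.c_v_self, map_neg, map_mul]; rfl
  · congr 1
    refine Finset.sum_congr rfl fun k hk => ?_
    rw [regC_apply, opR_regK X (T := -X.c (w⁻¹ k)) w, map_neg, LinearMap.neg_apply, map_neg]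
    · simp
    · rw [cliff_mul_one_sub_fst X.c_sq, mul_neg]

theorem regC_regY_of_ne (u : ℂ) (i j : Fin n) (h : i ≠ j) :
    regC X j * regY X u i = regY X u i * regC X j := by
  refine LinearMap.ext fun f => funext fun w => ?_
  rw [Module.End.mul_apply, Module.End.mul_apply, regC_apply,
    regY_apply, regY_apply, regC_apply, map_add, map_smul, map_sum]
  congr 1
  · rw [← Module.End.mul_apply, ← map_mul, X.c_v_of_ne _ _ (w⁻¹.injective.ne h),
      map_mul]; rfl
  · congr 1
    refine Finset.sum_congr rfl fun k hk => ?_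
    have hki := Finset.ne_of_mem_erase hk
    rw [regC_apply, opR_regK X (T := X.c ((Equiv.swap i k * w)⁻¹ j)) w]
    by_cases hjk : j = k
    · subst hjk
      rw [cliff_mul_one_sub_snd X.c_sq X.c_anti (w⁻¹.injective.ne h)]
      simp
    · rw [cliff_mul_one_sub_of_ne X.c_anti (w⁻¹.injective.ne h.symm) (w⁻¹.injective.ne hjk)]
      simp [Equiv.swap_apply_of_ne_of_ne h.symm hjk]

theorem regY_smul (u : ℂ) (i : Fin n) (p : GroupAlg n) (f : Reg n A) :
    regY X u i (p • f) - p • regY X u i f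
      = u • ∑ k ∈ Finset.univ.erase i,
          demazure i k p •
            ((1 - regC X i * regC X k) * regS (Equiv.swap i k) : Module.End ℂ (Reg n A)) f := by
  refine funext fun w => ?_
  have hsub : ∀ x y : GroupAlg n ⊗[ℂ] A, u • x - u • y = u • (x - y) :=
    fun x y => (smul_sub u x y).symm
  rw [Pi.sub_apply, Pi.smul_apply, regY_apply, regY_apply, Pi.smul_apply, opR_smul, smul_add,
    add_sub_add_left_eq_sub, smul_comm p u, hsub, Pi.smul_apply, Finset.sum_apply,
    Finset.smul_sum, ← Finset.sum_sub_distrib]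
  congr 1
  refine Finset.sum_congr rfl fun k hk => ?_
  rw [Pi.smul_apply, regK_smul X (Finset.ne_of_mem_erase hk), add_sub_cancel_left, Pi.smul_apply]
  congr 1
  simp [regC_apply, regS_apply]

/-- The induced module as an equivariant system. -/
def regSystem (u : ℂ) : DunklSystem n u (Module.End ℂ (Reg n A)) where
  e := Algebra.lsmul ℂ ℂ (Reg n A)
  s := regS
  c := regC X
  y := regY X u
  c_sq i := by
    refine LinearMap.ext fun f => funext fun w => ?_
    rw [Module.End.mul_apply, regC_apply, regC_apply, ← Module.End.mul_apply, ← map_mul,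
      X.c_sq, map_one]; rfl
  c_anti i j h := by
    refine LinearMap.ext fun f => funext fun w => ?_
    rw [LinearMap.neg_apply, Pi.neg_apply, Module.End.mul_apply, Module.End.mul_apply, regC_apply,
      regC_apply, regC_apply, regC_apply, ← Module.End.mul_apply, ← map_mul,
      X.c_anti _ _ (w⁻¹.injective.ne h), map_neg, map_mul]; rfl
  c_e i p := LinearMap.ext fun f => funext fun w => opR_smul _ p (f w)
  s_e σ p := LinearMap.ext fun f => funext fun w => opL_permAlg_smul σ p (f (σ⁻¹ * w))
  s_c σ i := by
    refine LinearMap.ext fun f => funext fun w => ?_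
    rw [Module.End.mul_apply, Module.End.mul_apply, regS_apply, regC_apply, regC_apply,
      regS_apply, opL_opR]
    simp
  s_y := regS_regY X u
  c_y := regC_regY_self X u
  c_y_ne := regC_regY_of_ne X u
  y_e i p := by
    refine LinearMap.ext fun f => ?_
    simpa using regY_smul X u i p f

/-- The element `1 ⊗ 1 ⊗ a` of the induced module. -/
def baseVec (a : A) : Reg n A := Pi.single 1 (1 ⊗ₜ a)

/-- On `1 ⊗ 1 ⊗ a` the Jucys-Murphy correction cancels the truncation in `y_b`. -/
theorem v_baseVec (u : ℂ) (b : Fin n) (a : A) :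
    (regSystem X u).v b (baseVec a) = baseVec (X.v b a) := by
  refine funext fun w => ?_
  have hterm : ∀ k ∈ Finset.univ.erase b,
      regK X b k w (baseVec a (Equiv.swap b k * w))
        + (if k < b then (regSystem X u).g b k (baseVec a) w else 0) = 0 := by
    intro k hk
    have hg : (regSystem X u).g b k (baseVec a) w
        = opR (1 - X.c (w⁻¹ b) * X.c (w⁻¹ k))
            (opL (permAlg (Equiv.swap b k)).toLinearMap (baseVec a (Equiv.swap b k * w))) := by
      simp [DunklSystem.g, regSystem, regC_apply, regS_apply]
    rw [hg]
    by_cases hw : w = Equiv.swap b k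
    · subst hw
      rw [Equiv.swap_mul_self, baseVec, Pi.single_eq_same, regK_apply, opL_opR, opL_tmul,
        opL_tmul, demazure_one (Finset.ne_of_mem_erase hk), TensorProduct.zero_tmul, map_zero,
        Equiv.swap_inv, Equiv.swap_apply_left, Equiv.swap_apply_right, AlgHom.toLinearMap_apply,
        map_one]
      split_ifs
      · abel
      · abel
    · have hw' : Equiv.swap b k * w ≠ 1 := fun e =>
        hw (by rw [← mul_right_inj (Equiv.swap b k), e, Equiv.swap_mul_self])
      rw [baseVec, Pi.single_eq_of_ne hw', map_zero, map_zero, map_zero]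
      simp
  have hjm : (regSystem X u).jm b (baseVec a) w
      = ∑ k ∈ Finset.univ.erase b,
          if k < b then (regSystem X u).g b k (baseVec a) w else 0 := by
    have hI : (Finset.univ.erase b).filter (· < b) = Finset.Iio b := by
      ext k; simp +contextual [ne_of_lt]
    rw [← Finset.sum_filter, hI, DunklSystem.jm, LinearMap.sum_apply, Finset.sum_apply]
  have hfirst : opR (X.v (w⁻¹ b)) (baseVec a w) = baseVec (X.v b a) w := by
    by_cases hw : w = 1
    · subst hw; simp [baseVec, opR_tmul]
    · rw [baseVec, baseVec, Pi.single_eq_of_ne hw, Pi.single_eq_of_ne hw, map_zero]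
  rw [DunklSystem.v, LinearMap.add_apply, LinearMap.smul_apply, Pi.add_apply, Pi.smul_apply, hjm]
  change regY X u b (baseVec a) w + _ = _
  rw [regY_apply, add_assoc, ← smul_add u, ← Finset.sum_add_distrib, Finset.sum_eq_zero hterm,
    smul_zero, add_zero, hfirst]

theorem regS_baseVec (σ : Equiv.Perm (Fin n)) (a : A) :
    regS σ (baseVec a) = Pi.single σ (1 ⊗ₜ a) := by
  refine funext fun w => ?_
  rw [regS_apply]
  by_cases hw : w = σ
  · subst hw; simp [baseVec, opL_tmul]
  · have hw' : σ⁻¹ * w ≠ 1 := fun e => hw (inv_mul_eq_one.mp e).symm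
    rw [baseVec, Pi.single_eq_of_ne hw', Pi.single_eq_of_ne hw, map_zero]

theorem smul_regS_baseVec (p : GroupAlg n) (σ : Equiv.Perm (Fin n)) (a : A) :
    p • regS σ (baseVec a) = Pi.single σ (p ⊗ₜ a) := by
  rw [regS_baseVec, ← Pi.single_smul, TensorProduct.smul_tmul', smul_eq_mul, mul_one]

/-- The curvature kills the vectors `1 ⊗ 1 ⊗ a`, since there the `ε_i^∨` act through the commuting
operators on `A`; it is compatible with `S_n` and `ℂ[P]`, which generate the module from these. -/
theorem regSystem_curv (u : ℂ) (a b : Fin n) (hab : a < b) : (regSystem X u).curv a b = 0 := by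
  have hbase : ∀ a b : Fin n, a ≠ b → ∀ x : A, (regSystem X u).curv a b (baseVec x) = 0 := by
    have hlt : ∀ a b : Fin n, a < b → ∀ x : A, (regSystem X u).curv a b (baseVec x) = 0 :=
      fun a b h x => by
        have hv := LinearMap.congr_fun (X.v_comm a b) x
        rw [Module.End.mul_apply, Module.End.mul_apply] at hv
        rw [← DunklSystem.v_commutator _ h, LinearMap.sub_apply, Module.End.mul_apply,
          Module.End.mul_apply, v_baseVec, v_baseVec, v_baseVec, v_baseVec, hv, sub_self]
    intro a b h x
    rcases lt_or_gt_of_ne h with h1 | h1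
    · exact hlt a b h1 x
    · rw [DunklSystem.curv_antisymm _ h1.ne, LinearMap.neg_apply, hlt b a h1, neg_zero]
  refine LinearMap.pi_ext' fun σ => TensorProduct.ext' fun p x => ?_
  have hs := (regSystem X u).s_curv σ (σ⁻¹ a) (σ⁻¹ b)
  rw [← Equiv.Perm.mul_apply, ← Equiv.Perm.mul_apply, mul_inv_cancel, Equiv.Perm.one_apply,
    Equiv.Perm.one_apply] at hs
  have h1 : (regSystem X u).curv a b (regS σ (baseVec x)) = 0 := by
    have := LinearMap.congr_fun hs (baseVec x)
    rw [Module.End.mul_apply, Module.End.mul_apply,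
      hbase _ _ (σ⁻¹.injective.ne hab.ne), map_zero] at this
    exact this.symm
  have h2 := LinearMap.congr_fun ((regSystem X u).curv_e hab.ne p) (regS σ (baseVec x))
  rw [Module.End.mul_apply, Module.End.mul_apply, h1, map_zero] at h2
  change (regSystem X u).curv a b (Pi.single σ (p ⊗ₜ x)) = 0
  rw [← smul_regS_baseVec]
  exact h2

end Induced

/-! ### The Clifford algebra and the polynomial algebra -/

section Concrete

variable (n : ℕ)

/-- The space `C_n ⊗ ℂ[ε_1^∨, …, ε_n^∨]`. -/
abbrev CliffPoly : Type := CliffordAlgebra (cliffForm n) ⊗[ℂ] MvPolynomial (Fin n) ℂ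

variable {n}

/-- The generator `c_i` of the Clifford algebra. -/
def cl (i : Fin n) : CliffordAlgebra (cliffForm n) :=
  CliffordAlgebra.ι (cliffForm n) (Pi.single i 1)

theorem cl_sq (i : Fin n) : cl i * cl i = 1 := by
  rw [cl, CliffordAlgebra.ι_sq_scalar]
  simp [QuadraticMap.weightedSumSquares_apply, Pi.single_apply]

theorem cl_anti (i j : Fin n) (h : i ≠ j) : cl i * cl j = -(cl j * cl i) := by
  rw [eq_neg_iff_add_eq_zero, cl, cl, CliffordAlgebra.ι_mul_ι_add_swap]
  simp [QuadraticMap.polar, QuadraticMap.weightedSumSquares_apply, Pi.single_apply,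
    mul_add, Finset.sum_add_distrib, h, h.symm]

/-- The isometry changing the sign of the `i`-th coordinate. -/
def flipIsometry (i : Fin n) : cliffForm n →qᵢ cliffForm n where
  toFun x j := if j = i then -x j else x j
  map_add' x y := by
    funext j; simp only [Pi.add_apply]; split_ifs <;> ring
  map_smul' r x := by
    funext j; simp only [Pi.smul_apply, smul_eq_mul, RingHom.id_apply]; split_ifs <;> ring
  map_app' x := by
    simp only [QuadraticMap.weightedSumSquares_apply]
    refine Finset.sum_congr rfl fun j _ => ?_
    split_ifs <;> ring

theorem flipIsometry_apply (i : Fin n) (x : Fin n → ℂ) (j : Fin n) :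
    flipIsometry i x j = if j = i then -x j else x j := rfl

/-- The automorphism of the Clifford algebra with `c_i ↦ -c_i` and `c_j ↦ c_j` for `j ≠ i`. -/
def cliffFlip (i : Fin n) : CliffordAlgebra (cliffForm n) →ₐ[ℂ] CliffordAlgebra (cliffForm n) :=
  CliffordAlgebra.map (flipIsometry i)

theorem cliffFlip_cl_self (i : Fin n) : cliffFlip i (cl i) = -cl i := by
  rw [cliffFlip, cl, CliffordAlgebra.map_apply_ι, ← map_neg]
  congr 1; funext j
  by_cases h : j = i
  · subst h; simp [flipIsometry_apply]
  · simp [flipIsometry_apply, h]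

theorem cliffFlip_cl_of_ne {i j : Fin n} (h : j ≠ i) : cliffFlip i (cl j) = cl j := by
  rw [cliffFlip, cl, CliffordAlgebra.map_apply_ι]
  congr 1; funext k
  by_cases hk : k = i
  · subst hk; simp [flipIsometry_apply, h.symm]
  · simp [flipIsometry_apply, hk]

/-- Algebra homomorphisms out of the Clifford algebra agreeing on the `c_j` are equal. -/
theorem cliff_algHom_ext {A : Type*} [Semiring A] [Algebra ℂ A]
    {f g : CliffordAlgebra (cliffForm n) →ₐ[ℂ] A} (h : ∀ j, f (cl j) = g (cl j)) : f = g := by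
  apply CliffordAlgebra.hom_ext
  refine LinearMap.pi_ext' fun j => LinearMap.ext_ring ?_
  simpa [cl] using h j

theorem cliffFlip_comm (i j : Fin n) (x : CliffordAlgebra (cliffForm n)) :
    cliffFlip i (cliffFlip j x) = cliffFlip j (cliffFlip i x) := by
  have : (cliffFlip i).comp (cliffFlip j) = (cliffFlip j).comp (cliffFlip i) := by
    refine cliff_algHom_ext fun k => ?_
    rw [AlgHom.comp_apply, AlgHom.comp_apply]
    by_cases hi : k = i <;> by_cases hj : k = j
    · rw [← hi, ← hj]
    · rw [cliffFlip_cl_of_ne hj, hi, cliffFlip_cl_self, map_neg, cliffFlip_cl_of_ne (hi ▸ hj)]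
    · rw [cliffFlip_cl_of_ne hi, hj, cliffFlip_cl_self, map_neg, cliffFlip_cl_of_ne (hj ▸ hi)]
    · rw [cliffFlip_cl_of_ne hj, cliffFlip_cl_of_ne hi, cliffFlip_cl_of_ne hj]
  exact DFunLike.congr_fun this x

/-- Left multiplication by `c_i` on `C_n ⊗ ℂ[ε_1^∨, …, ε_n^∨]`. -/
def cliffOp (i : Fin n) : Module.End ℂ (CliffPoly n) :=
  TensorProduct.map (LinearMap.mulLeft ℂ (cl i)) LinearMap.id

/-- Left multiplication by `ε_i^∨` on `C_n ⊗ ℂ[ε_1^∨, …, ε_n^∨]`, where `ε_i^∨` anticommutes with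
`c_i` and commutes with the other `c_j`. -/
def corootOp (i : Fin n) : Module.End ℂ (CliffPoly n) :=
  TensorProduct.map (cliffFlip i).toLinearMap (LinearMap.mulLeft ℂ (MvPolynomial.X i))

theorem cliffOp_tmul (i : Fin n) (c : CliffordAlgebra (cliffForm n)) (f : MvPolynomial (Fin n) ℂ) :
    cliffOp i (c ⊗ₜ f) = (cl i * c) ⊗ₜ f := rfl

theorem corootOp_tmul (i : Fin n) (c : CliffordAlgebra (cliffForm n))
    (f : MvPolynomial (Fin n) ℂ) :
    corootOp i (c ⊗ₜ f) = cliffFlip i c ⊗ₜ (MvPolynomial.X i * f) := rfl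

theorem cliffOp_sq (i : Fin n) : cliffOp i * cliffOp i = 1 := by
  refine TensorProduct.ext' fun c f => ?_
  rw [Module.End.mul_apply, cliffOp_tmul, cliffOp_tmul, ← mul_assoc, cl_sq, one_mul]; rfl

theorem cliffOp_anti (i j : Fin n) (h : i ≠ j) :
    cliffOp i * cliffOp j = -(cliffOp j * cliffOp i) := by
  refine TensorProduct.ext' fun c f => ?_
  rw [LinearMap.neg_apply, Module.End.mul_apply, Module.End.mul_apply, cliffOp_tmul, cliffOp_tmul,
    cliffOp_tmul, cliffOp_tmul, ← mul_assoc, cl_anti i j h, ← mul_assoc, neg_mul,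
    TensorProduct.neg_tmul]

theorem cliffOp_corootOp (i : Fin n) : cliffOp i * corootOp i = -(corootOp i * cliffOp i) := by
  refine TensorProduct.ext' fun c f => ?_
  rw [LinearMap.neg_apply, Module.End.mul_apply, Module.End.mul_apply, cliffOp_tmul, corootOp_tmul,
    cliffOp_tmul, corootOp_tmul, map_mul, cliffFlip_cl_self, neg_mul,
    TensorProduct.neg_tmul, neg_neg]

theorem cliffOp_corootOp_of_ne (i j : Fin n) (h : i ≠ j) :
    cliffOp j * corootOp i = corootOp i * cliffOp j := by
  refine TensorProduct.ext' fun c f => ?_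
  rw [Module.End.mul_apply, Module.End.mul_apply, cliffOp_tmul, corootOp_tmul,
    cliffOp_tmul, corootOp_tmul, map_mul, cliffFlip_cl_of_ne h.symm]

theorem corootOp_comm (i j : Fin n) : corootOp i * corootOp j = corootOp j * corootOp i := by
  refine TensorProduct.ext' fun c f => ?_
  rw [Module.End.mul_apply, Module.End.mul_apply, corootOp_tmul, corootOp_tmul,
    corootOp_tmul, corootOp_tmul, cliffFlip_comm, mul_left_comm]

variable (n) in
/-- The regular module of the subalgebra generated by the `c_i` and the `ε_i^∨`. -/
def cliffPolyModule : CliffCorootModule n (CliffPoly n) where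
  c := cliffOp
  v := corootOp
  c_sq := cliffOp_sq
  c_anti := cliffOp_anti
  c_v_self := cliffOp_corootOp
  c_v_of_ne := cliffOp_corootOp_of_ne
  v_comm := corootOp_comm

theorem cliff_induction {motive : CliffordAlgebra (cliffForm n) → Prop}
    (c : CliffordAlgebra (cliffForm n)) (halg : ∀ r, motive (algebraMap ℂ _ r))
    (hcl : ∀ i, motive (cl i)) (hadd : ∀ x y, motive x → motive y → motive (x + y))
    (hmul : ∀ x y, motive x → motive y → motive (x * y)) : motive c := by
  induction c using CliffordAlgebra.induction with
  | algebraMap r => exact halg r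
  | add x y hx hy => exact hadd x y hx hy
  | mul x y hx hy => exact hmul x y hx hy
  | ι v =>
    rw [pi_eq_sum_univ' v, map_sum]
    refine Finset.sum_induction _ motive hadd (by simpa using halg 0) fun i _ => ?_
    rw [map_smul, Algebra.smul_def]
    exact hmul _ _ (halg _) (by simpa [cl] using hcl i)

variable (u : ℂ)

variable (n) in
/-- The representation of the trigonometric double affine Hecke-Clifford algebra on the module
`ℂ[P] ⊗ ℂ S_n ⊗ C_n ⊗ ℂ[ε_1^∨, …, ε_n^∨]`. -/
def regRep : TrigDaHCa n u →ₐ[ℂ] Module.End ℂ (Reg n (CliffPoly n)) :=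
  (regSystem (cliffPolyModule n) u).hom (regSystem_curv (cliffPolyModule n) u)

theorem regRep_corootHom (f g : MvPolynomial (Fin n) ℂ) :
    regRep n u (corootHom u f) (baseVec (1 ⊗ₜ g)) = baseVec (1 ⊗ₜ (f * g)) := by
  induction f using MvPolynomial.induction_on generalizing g with
  | C a =>
    rw [← MvPolynomial.algebraMap_eq, AlgHom.commutes, AlgHom.commutes, Module.algebraMap_end_apply,
      ← Algebra.smul_def, baseVec, baseVec, ← Pi.single_smul, TensorProduct.tmul_smul,
      TensorProduct.tmul_smul]
  | add p q hp hq =>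
    rw [map_add, map_add, LinearMap.add_apply, hp, hq, add_mul, TensorProduct.tmul_add, baseVec,
      baseVec, baseVec, TensorProduct.tmul_add, Pi.single_add]
  | mul_X p i hp =>
    rw [map_mul, corootHom_X, map_mul, Module.End.mul_apply, regRep, DunklSystem.hom_gV, v_baseVec,
      ← regRep]
    change regRep n u (corootHom u p) (baseVec (corootOp i (1 ⊗ₜ g))) = _
    rw [corootOp_tmul, map_one, hp, mul_assoc]

theorem regRep_cliffHom (c d : CliffordAlgebra (cliffForm n)) (g : MvPolynomial (Fin n) ℂ) :
    regRep n u (cliffHom u c) (baseVec (d ⊗ₜ g)) = baseVec ((c * d) ⊗ₜ g) := by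
  induction c using cliff_induction generalizing d with
  | halg r =>
    rw [AlgHom.commutes, AlgHom.commutes, Module.algebraMap_end_apply,
      ← Algebra.smul_def, baseVec, baseVec, ← Pi.single_smul, ← TensorProduct.smul_tmul',
      TensorProduct.tmul_smul]
  | hcl i =>
    rw [cl, cliffHom_ι, ← cl, regRep, DunklSystem.hom_gC]
    refine funext fun w => ?_
    change regC (cliffPolyModule n) i _ w = _
    rw [regC_apply]
    by_cases hw : w = 1
    · subst hw; rw [baseVec, baseVec, Pi.single_eq_same, Pi.single_eq_same]; rfl
    · rw [baseVec, baseVec, Pi.single_eq_of_ne hw, Pi.single_eq_of_ne hw, map_zero]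
  | hadd x y hx hy =>
    rw [map_add, map_add, LinearMap.add_apply, hx, hy, add_mul, TensorProduct.add_tmul, baseVec,
      baseVec, baseVec, TensorProduct.tmul_add, Pi.single_add]
  | hmul x y hx hy =>
    rw [map_mul, map_mul, Module.End.mul_apply, hy, hx, mul_assoc]

/-- The ordered product `p w c f` acts on `1 ⊗ 1 ⊗ 1 ⊗ 1` by producing `p ⊗ w ⊗ c ⊗ f`. -/
theorem regRep_ordered (p : GroupAlg n) (σ : Equiv.Perm (Fin n))
    (c : CliffordAlgebra (cliffForm n)) (f : MvPolynomial (Fin n) ℂ) :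
    regRep n u (expHom u p * gS u σ * cliffHom u c * corootHom u f) (baseVec (1 ⊗ₜ 1))
      = Pi.single σ (p ⊗ₜ (c ⊗ₜ f)) := by
  rw [map_mul, Module.End.mul_apply, regRep_corootHom, map_mul, Module.End.mul_apply,
    regRep_cliffHom, map_mul, Module.End.mul_apply, mul_one, mul_one, regRep,
    DunklSystem.hom_gS, DunklSystem.hom_expHom]
  exact smul_regS_baseVec p σ _

end Concrete

/-! ### Spanning by ordered products -/

section Spanning

variable {n : ℕ} (u : ℂ)

variable (n) in
/-- The multiplication map `p ⊗ w ⊗ c ⊗ f ↦ p w c f`. -/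
def mulMap : (GroupAlg n ⊗[ℂ] (MonoidAlgebra ℂ (Equiv.Perm (Fin n)) ⊗[ℂ]
    (CliffordAlgebra (cliffForm n) ⊗[ℂ] MvPolynomial (Fin n) ℂ))) →ₗ[ℂ] TrigDaHCa n u :=
  LinearMap.mul' ℂ _ ∘ₗ TensorProduct.map (expHom u).toLinearMap
    (LinearMap.mul' ℂ _ ∘ₗ TensorProduct.map (permHom u).toLinearMap
      (LinearMap.mul' ℂ _ ∘ₗ TensorProduct.map (cliffHom u).toLinearMap
        (corootHom u).toLinearMap))

theorem mulMap_tmul (p : GroupAlg n) (w : MonoidAlgebra ℂ (Equiv.Perm (Fin n)))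
    (c : CliffordAlgebra (cliffForm n)) (f : MvPolynomial (Fin n) ℂ) :
    mulMap n u (p ⊗ₜ (w ⊗ₜ (c ⊗ₜ f)))
      = expHom u p * permHom u w * cliffHom u c * corootHom u f := by
  simp [mulMap, mul_assoc]

/-- Linear maps out of the fourfold tensor product agree if they agree on the pure tensors whose
second factor is a permutation. -/
theorem tensor_ext {M : Type*} [AddCommMonoid M] [Module ℂ M]
    {S T : (GroupAlg n ⊗[ℂ] (MonoidAlgebra ℂ (Equiv.Perm (Fin n)) ⊗[ℂ]
      (CliffordAlgebra (cliffForm n) ⊗[ℂ] MvPolynomial (Fin n) ℂ))) →ₗ[ℂ] M}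
    (h : ∀ p σ c f, S (p ⊗ₜ (MonoidAlgebra.single σ 1 ⊗ₜ (c ⊗ₜ f)))
      = T (p ⊗ₜ (MonoidAlgebra.single σ 1 ⊗ₜ (c ⊗ₜ f)))) : S = T := by
  refine TensorProduct.ext (LinearMap.ext fun p => TensorProduct.ext ?_)
  refine MonoidAlgebra.lhom_ext' fun σ => LinearMap.ext_ring ?_
  exact TensorProduct.ext' fun c f => h p σ c f

variable (n) in
/-- The span of the ordered products. -/
def orderedSpan : Submodule ℂ (TrigDaHCa n u) := LinearMap.range (mulMap n u)

theorem ordered_mem (p : GroupAlg n) (σ : Equiv.Perm (Fin n)) (c : CliffordAlgebra (cliffForm n))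
    (f : MvPolynomial (Fin n) ℂ) :
    expHom u p * gS u σ * cliffHom u c * corootHom u f ∈ orderedSpan n u :=
  ⟨p ⊗ₜ (MonoidAlgebra.single σ 1 ⊗ₜ (c ⊗ₜ f)), by rw [mulMap_tmul, permHom_single]⟩

variable (n) in
/-- The elements whose left multiplication preserves the span of the ordered products. -/
def stabilizer : Subalgebra ℂ (TrigDaHCa n u) where
  carrier := {a | ∀ x ∈ orderedSpan n u, a * x ∈ orderedSpan n u}
  mul_mem' := fun {a b} ha hb x hx => by rw [mul_assoc]; exact ha _ (hb x hx)
  add_mem' := fun {a b} ha hb x hx => by rw [add_mul]; exact add_mem (ha x hx) (hb x hx)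
  algebraMap_mem' := fun r x hx => by
    rw [← Algebra.smul_def]; exact Submodule.smul_mem _ r hx

theorem mem_stabilizer {a : TrigDaHCa n u}
    (h : ∀ p σ c f, a * (expHom u p * gS u σ * cliffHom u c * corootHom u f) ∈ orderedSpan n u) :
    a ∈ stabilizer n u := by
  rintro _ ⟨m, rfl⟩
  have key : (orderedSpan n u).mkQ ∘ₗ LinearMap.mulLeft ℂ a ∘ₗ mulMap n u = 0 := by
    refine tensor_ext fun p σ c f => ?_
    rw [LinearMap.comp_apply, LinearMap.comp_apply, mulMap_tmul, permHom_single,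
      LinearMap.mulLeft_apply, LinearMap.zero_apply, Submodule.mkQ_apply,
      Submodule.Quotient.mk_eq_zero]
    exact h p σ c f
  have := LinearMap.congr_fun key m
  rwa [LinearMap.comp_apply, LinearMap.comp_apply, LinearMap.mulLeft_apply, LinearMap.zero_apply,
      Submodule.mkQ_apply, Submodule.Quotient.mk_eq_zero] at this

theorem expHom_mem_stabilizer (q : GroupAlg n) : expHom u q ∈ stabilizer n u :=
  mem_stabilizer u fun p σ c f => by
    rw [← mul_assoc, ← mul_assoc, ← mul_assoc, ← map_mul]
    exact ordered_mem u _ _ _ _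

/-- The generator `e^{-ε_i}` is the image of `e^{-ε_i} ∈ ℂ[P]`. -/
theorem gE'_eq (i : Fin n) : gE' u i = expHom u (ex (-ep i)) := by
  have h1 : gE' u i * gE u i = 1 := (unitE u i).inv_val
  have h2 : gE u i * expHom u (ex (-ep i)) = 1 := by
    rw [← expHom_ep, ← map_mul, ex_mul, add_neg_cancel, ← map_one (expHom u)]; rfl
  exact left_inv_eq_right_inv h1 h2

theorem gS_mul (σ τ : Equiv.Perm (Fin n)) : gS u σ * gS u τ = gS u (σ * τ) := by
  simpa [gS] using mk_rel u (Rel.perm_mul σ τ)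

theorem gS_one : gS u (1 : Equiv.Perm (Fin n)) = 1 := by
  simpa [gS] using mk_rel u Rel.perm_one

theorem gS_expHom (σ : Equiv.Perm (Fin n)) (p : GroupAlg n) :
    gS u σ * expHom u p = expHom u (permAlg σ p) * gS u σ :=
  intertwine_groupAlg (expHom u) _ (permAlg σ) (fun i => by
    rw [permAlg_ex, permWeight_ep, expHom_ep, expHom_ep]
    simpa [gS, gE] using mk_rel u (Rel.perm_exp σ i)) p

theorem gC_expHom (i : Fin n) (p : GroupAlg n) :
    gC u i * expHom u p = expHom u p * gC u i :=
  intertwine_groupAlg (expHom u) _ (AlgHom.id ℂ _) (fun j => by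
    rw [AlgHom.id_apply, expHom_ep]
    simpa [gC, gE] using mk_rel u (Rel.cliff_exp j i)) p

theorem gS_gC (σ : Equiv.Perm (Fin n)) (i : Fin n) :
    gS u σ * gC u i = gC u (σ i) * gS u σ := by
  simpa [gS, gC] using mk_rel u (Rel.perm_cliff σ i)

theorem gS_mem_stabilizer (τ : Equiv.Perm (Fin n)) : gS u τ ∈ stabilizer n u :=
  mem_stabilizer u fun p σ c f => by
    rw [← mul_assoc, ← mul_assoc, ← mul_assoc, gS_expHom, mul_assoc (expHom u _), gS_mul]
    exact ordered_mem u _ _ _ _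

theorem gC_mem_stabilizer (i : Fin n) : gC u i ∈ stabilizer n u :=
  mem_stabilizer u fun p σ c f => by
    have h : gC u i * gS u σ = gS u σ * gC u (σ⁻¹ i) := by
      rw [gS_gC, ← Equiv.Perm.mul_apply, mul_inv_cancel, Equiv.Perm.one_apply]
    rw [← mul_assoc, ← mul_assoc, ← mul_assoc, gC_expHom, mul_assoc (expHom u _), h,
      ← mul_assoc, mul_assoc _ (gC u _), ← cliffHom_ι, ← map_mul]
    exact ordered_mem u _ _ _ _

theorem gV_cliffHom (i : Fin n) (c : CliffordAlgebra (cliffForm n)) :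
    gV u i * cliffHom u c = cliffHom u (cliffFlip i c) * gV u i := by
  induction c using cliff_induction with
  | halg r => rw [AlgHom.commutes, AlgHom.commutes, AlgHom.commutes, Algebra.commutes]
  | hcl j =>
    have hcl : ∀ j : Fin n, cliffHom u (cl j) = gC u j := cliffHom_ι u
    -- stated for an abstract ring, since `rw` does not see through the negation of `RingQuot`
    have hneg : ∀ {R : Type} [Ring R] (a b : R), a * b = -(b * a) → b * a = -a * b :=
      fun a b h => by rw [neg_mul, h, neg_neg]
    by_cases h : j = i
    · subst h
      have h1 : gC u j * gV u j = -(gV u j * gC u j) := by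
        simpa [gC, gV] using mk_rel u (Rel.cliff_coroot j)
      rw [cliffFlip_cl_self, map_neg, hcl]
      exact hneg _ _ h1
    · have h1 : gC u j * gV u i = gV u i * gC u j := by
        simpa [gC, gV] using mk_rel u (Rel.cliff_coroot_ne i j (Ne.symm h))
      rw [cliffFlip_cl_of_ne h, hcl, h1]
  | hadd x y hx hy => simp only [map_add, mul_add, add_mul, hx, hy]
  | hmul x y hx hy => rw [map_mul, ← mul_assoc, hx, mul_assoc, hy, map_mul, map_mul, mul_assoc]

variable (n) in
/-- The subalgebra generated by `S_n` and the `c_i`. -/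
def sergeev : Subalgebra ℂ (TrigDaHCa n u) :=
  Algebra.adjoin ℂ (Set.range (gS u) ∪ Set.range (gC u))

theorem gS_mem_sergeev (σ : Equiv.Perm (Fin n)) : gS u σ ∈ sergeev n u :=
  Algebra.subset_adjoin (Or.inl ⟨σ, rfl⟩)

theorem gC_mem_sergeev (i : Fin n) : gC u i ∈ sergeev n u :=
  Algebra.subset_adjoin (Or.inr ⟨i, rfl⟩)

theorem sergeev_le_stabilizer : sergeev n u ≤ stabilizer n u := by
  refine Algebra.adjoin_le ?_
  rintro _ (⟨σ, rfl⟩ | ⟨i, rfl⟩)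
  · exact gS_mem_stabilizer u σ
  · exact gC_mem_stabilizer u i

theorem gV_gS_swap_mem {i i' : Fin n} (h : (i' : ℕ) = i + 1) (j : Fin n) :
    gV u j * gS u (Equiv.swap i i') - gS u (Equiv.swap i i') * gV u (Equiv.swap i i' j)
      ∈ sergeev n u := by
  have hrel : gV u i' * gS u (Equiv.swap i i') - gS u (Equiv.swap i i') * gV u i
      = u • (1 - gC u i' * gC u i) := by
    simpa [gV, gS, gC] using mk_rel u (Rel.coroot_simple i i' h)
  have hmem : u • (1 - gC u i' * gC u i) ∈ sergeev n u :=
    Subalgebra.smul_mem _ (sub_mem (one_mem _)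
      (mul_mem (gC_mem_sergeev u i') (gC_mem_sergeev u i))) u
  have hss : gS u (Equiv.swap i i') * gS u (Equiv.swap i i') = 1 := by
    rw [gS_mul, Equiv.swap_mul_self, gS_one]
  by_cases hji' : j = i'
  · rw [hji', Equiv.swap_apply_right, hrel]; exact hmem
  by_cases hji : j = i
  · -- conjugate the relation for `i'` by the simple reflection
    have h1 : gV u i * gS u (Equiv.swap i i') - gS u (Equiv.swap i i') * gV u i'
        = -(gS u (Equiv.swap i i') * (u • (1 - gC u i' * gC u i)) * gS u (Equiv.swap i i')) := by
      rw [← hrel]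
      generalize gS u (Equiv.swap i i') = s at hss
      calc gV u i * s - s * gV u i' = (s * s) * gV u i * s - s * gV u i' * (s * s) := by
            rw [hss, one_mul, mul_one]
        _ = _ := by simp only [mul_sub, sub_mul, mul_assoc, neg_sub]
    rw [hji, Equiv.swap_apply_left, h1]
    exact neg_mem (mul_mem (mul_mem (gS_mem_sergeev u _) hmem) (gS_mem_sergeev u _))
  · have h1 : gV u j * gS u (Equiv.swap i i') = gS u (Equiv.swap i i') * gV u j := by
      simpa [gV, gS] using mk_rel u (Rel.coroot_simple_ne i i' j h hji hji')
    rw [Equiv.swap_apply_of_ne_of_ne hji hji', h1, sub_self]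
    exact zero_mem _

/-- Moving `ε_j^∨` past a permutation produces an error term without any `ε_i^∨`. -/
theorem gV_gS_mem (σ : Equiv.Perm (Fin n)) (j : Fin n) :
    gV u j * gS u σ - gS u σ * gV u (σ⁻¹ j) ∈ sergeev n u := by
  obtain _ | m := n
  · exact j.elim0
  have hσ : σ ∈ Submonoid.closure
      (Set.range fun i : Fin m ↦ Equiv.swap i.castSucc i.succ) := by
    rw [Equiv.Perm.mclosure_swap_castSucc_succ]; trivial
  induction hσ using Submonoid.closure_induction generalizing j with
  | mem τ hτ =>
    obtain ⟨i, rfl⟩ := hτ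
    rw [Equiv.swap_inv]
    exact gV_gS_swap_mem u (by simp) j
  | one => rw [gS_one, inv_one, Equiv.Perm.one_apply, mul_one, one_mul, sub_self]; exact zero_mem _
  | mul σ τ _ _ hσ hτ =>
    have h : gV u j * gS u (σ * τ) - gS u (σ * τ) * gV u ((σ * τ)⁻¹ j)
        = (gV u j * gS u σ - gS u σ * gV u (σ⁻¹ j)) * gS u τ
          + gS u σ * (gV u (σ⁻¹ j) * gS u τ - gS u τ * gV u (τ⁻¹ (σ⁻¹ j))) := by
      rw [← gS_mul, mul_inv_rev, Equiv.Perm.mul_apply]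
      simp only [mul_sub, sub_mul, mul_assoc, sub_add_sub_cancel]
    rw [h]
    exact add_mem (mul_mem (hσ j) (gS_mem_sergeev u τ)) (mul_mem (gS_mem_sergeev u σ) (hτ _))

theorem gV_expHom_ex (i : Fin n) (η : Weight n) :
    gV u i * expHom u (ex η) - expHom u (ex η) * gV u i ∈ stabilizer n u := by
  have h := mk_rel u (Rel.coroot_exp i η)
  simp only [map_sub, map_mul, map_smul, map_sum, map_one, mk_expLift, ← expHom_ex] at h
  change gV u i * expHom u (ex η) - expHom u (ex η) * gV u i = _ at h
  rw [h]
  refine Subalgebra.smul_mem _ (sum_mem fun k _ => Subalgebra.smul_mem _ (mul_mem (mul_mem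
    (expHom_mem_stabilizer u _) (sub_mem (one_mem _) (mul_mem ?_ ?_))) ?_) _) _
  · exact gC_mem_stabilizer u i
  · exact gC_mem_stabilizer u k
  · exact gS_mem_stabilizer u _

theorem gV_mem_stabilizer (i : Fin n) : gV u i ∈ stabilizer n u := by
  have hcf : ∀ j c f, gV u j * (cliffHom u c * corootHom u f) ∈ orderedSpan n u := fun j c f => by
    have := ordered_mem u 1 1 (cliffFlip j c) (MvPolynomial.X j * f)
    rw [map_one, gS_one, one_mul, one_mul, map_mul, corootHom_X, ← mul_assoc, ← gV_cliffHom,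
      mul_assoc] at this
    exact this
  have hscf : ∀ σ c f, gV u i * (gS u σ * cliffHom u c * corootHom u f) ∈ orderedSpan n u :=
    fun σ c f => by
      have e : gV u i * (gS u σ * cliffHom u c * corootHom u f)
          = (gV u i * gS u σ - gS u σ * gV u (σ⁻¹ i)) * (cliffHom u c * corootHom u f)
            + gS u σ * (gV u (σ⁻¹ i) * (cliffHom u c * corootHom u f)) := by
        simp only [sub_mul, mul_assoc, sub_add_cancel]
      rw [e]
      refine add_mem (sergeev_le_stabilizer u (gV_gS_mem u σ i) _ ?_)
        (gS_mem_stabilizer u σ _ (hcf _ _ _))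
      simpa [gS_one] using ordered_mem u 1 1 c f
  refine mem_stabilizer u fun p σ c f => ?_
  have hx : gS u σ * cliffHom u c * corootHom u f ∈ orderedSpan n u := by
    simpa using ordered_mem u 1 σ c f
  rw [mul_assoc (expHom u p * _), mul_assoc (expHom u p), ← mul_assoc (gS u σ)]
  induction p using groupAlg_induction with
  | hadd p q hp hq => rw [map_add, add_mul, mul_add]; exact add_mem hp hq
  | hsmul r p hp =>
    rw [map_smul, smul_mul_assoc, mul_smul_comm]; exact Submodule.smul_mem _ r hp
  | hex η =>
    have e : ∀ x, gV u i * (expHom u (ex η) * x)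
        = (gV u i * expHom u (ex η) - expHom u (ex η) * gV u i) * x
          + expHom u (ex η) * (gV u i * x) := fun x => by
      simp only [sub_mul, mul_assoc, sub_add_cancel]
    rw [e]
    exact add_mem (gV_expHom_ex u i η _ hx) (expHom_mem_stabilizer u _ _ (hscf σ c f))

theorem stabilizer_eq_top : stabilizer n u = ⊤ := by
  rw [eq_top_iff]
  rintro x -
  obtain ⟨y, rfl⟩ : ∃ y, mk n u y = x := RingQuot.mkAlgHom_surjective ℂ (Rel n u) x
  induction y using FreeAlgebra.induction with
  | grade0 r => rw [AlgHom.commutes]; exact Subalgebra.algebraMap_mem _ r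
  | add a b ha hb => rw [map_add]; exact add_mem ha hb
  | mul a b ha hb => rw [map_mul]; exact mul_mem ha hb
  | grade1 g =>
    cases g with
    | expPos i =>
      change gE u i ∈ _
      rw [← expHom_ep]; exact expHom_mem_stabilizer u _
    | expNeg i =>
      change gE' u i ∈ _
      rw [gE'_eq]; exact expHom_mem_stabilizer u _
    | coroot i => exact gV_mem_stabilizer u i
    | cliff i => exact gC_mem_stabilizer u i
    | perm σ => exact gS_mem_stabilizer u σ

theorem mulMap_surjective : Function.Surjective (mulMap n u) := fun x => by
  have hx : x ∈ stabilizer n u := by rw [stabilizer_eq_top]; trivial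
  have h := hx 1 (by simpa [gS_one] using ordered_mem u 1 1 1 1)
  rw [mul_one] at h
  exact h

end Spanning

/-! ### Linear independence of ordered products -/

section Independence

variable {n : ℕ} (u : ℂ)

variable (n) in
/-- The identification of functions `S_n → ℂ[P] ⊗ (C_n ⊗ ℂ[ε^∨])` with elements of the fourfold
tensor product. -/
def regToTensor : Reg n (CliffPoly n) →ₗ[ℂ] (GroupAlg n ⊗[ℂ] (MonoidAlgebra ℂ
    (Equiv.Perm (Fin n)) ⊗[ℂ] CliffPoly n)) :=
  ∑ w : Equiv.Perm (Fin n), (TensorProduct.leftComm ℂ _ _ _).toLinearMap ∘ₗ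
    TensorProduct.mk ℂ (MonoidAlgebra ℂ (Equiv.Perm (Fin n))) _ (MonoidAlgebra.single w 1) ∘ₗ
      LinearMap.proj w

theorem regToTensor_single (σ : Equiv.Perm (Fin n)) (p : GroupAlg n) (a : CliffPoly n) :
    regToTensor n (Pi.single σ (p ⊗ₜ a)) = p ⊗ₜ (MonoidAlgebra.single σ 1 ⊗ₜ a) := by
  rw [regToTensor, LinearMap.sum_apply, Finset.sum_eq_single σ]
  · simp
  · intro w _ hw
    simp [Pi.single_eq_of_ne hw]
  · simp

theorem mulMap_injective : Function.Injective (mulMap n u) := by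
  have key : regToTensor n ∘ₗ LinearMap.applyₗ (baseVec (1 ⊗ₜ 1)) ∘ₗ
      (regRep n u).toLinearMap ∘ₗ mulMap n u = LinearMap.id := by
    refine tensor_ext fun p σ c f => ?_
    rw [LinearMap.comp_apply, LinearMap.comp_apply, LinearMap.comp_apply, mulMap_tmul,
      permHom_single, LinearMap.applyₗ_apply_apply, AlgHom.toLinearMap_apply, regRep_ordered,
      regToTensor_single, LinearMap.id_apply]
  exact Function.LeftInverse.injective
    (g := regToTensor n ∘ₗ LinearMap.applyₗ (baseVec (1 ⊗ₜ 1)) ∘ₗ (regRep n u).toLinearMap)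
    (LinearMap.congr_fun key)

theorem tmul_right_injective {V W : Type*} [AddCommGroup V] [Module ℂ V] [AddCommGroup W]
    [Module ℂ W] {x : W} (hx : x ≠ 0) : Function.Injective fun v : V => v ⊗ₜ[ℂ] x := by
  obtain ⟨φ, hφ⟩ := Module.Projective.exists_dual_ne_zero ℂ hx
  intro v v' h
  have h1 := congrArg (TensorProduct.rid ℂ V ∘ LinearMap.lTensor V φ) h
  simp only [Function.comp_apply, LinearMap.lTensor_tmul, TensorProduct.rid_tmul] at h1
  exact smul_right_injective V hφ h1

theorem tmul_left_injective {V W : Type*} [AddCommGroup V] [Module ℂ V] [AddCommGroup W]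
    [Module ℂ W] {x : V} (hx : x ≠ 0) : Function.Injective fun w : W => x ⊗ₜ[ℂ] w :=
  fun w w' h => tmul_right_injective hx
    ((TensorProduct.comm ℂ V W).symm.injective (by simpa using h))

theorem tmul_ne_zero {V W : Type*} [AddCommGroup V] [Module ℂ V] [AddCommGroup W]
    [Module ℂ W] {x : V} {y : W} (hx : x ≠ 0) (hy : y ≠ 0) : x ⊗ₜ[ℂ] y ≠ 0 := fun h =>
  hx (tmul_right_injective hy (h.trans (TensorProduct.zero_tmul V y).symm))

end Independence

end TrigDaHCa

end

theorem mainTheorem11 (n : ℕ) (u : ℂ) :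
    (∃ Φ : (TrigDaHCa.GroupAlg n ⊗[ℂ] (MonoidAlgebra ℂ (Equiv.Perm (Fin n)) ⊗[ℂ]
        (CliffordAlgebra (TrigDaHCa.cliffForm n) ⊗[ℂ] MvPolynomial (Fin n) ℂ)))
          ≃ₗ[ℂ] TrigDaHCa n u,
      ∀ (p : TrigDaHCa.GroupAlg n) (w : MonoidAlgebra ℂ (Equiv.Perm (Fin n)))
        (c : CliffordAlgebra (TrigDaHCa.cliffForm n)) (f : MvPolynomial (Fin n) ℂ),
        Φ (p ⊗ₜ[ℂ] (w ⊗ₜ[ℂ] (c ⊗ₜ[ℂ] f))) =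
          TrigDaHCa.expHom u p * TrigDaHCa.permHom u w * TrigDaHCa.cliffHom u c *
            TrigDaHCa.corootHom u f) ∧
    Function.Injective (TrigDaHCa.expHom (n := n) u) ∧
    Function.Injective (TrigDaHCa.permHom (n := n) u) ∧
    Function.Injective (TrigDaHCa.cliffHom (n := n) u) ∧
    Function.Injective (TrigDaHCa.corootHom (n := n) u) := by
  have hΦ := TrigDaHCa.mulMap_tmul (n := n) u
  have hinj := TrigDaHCa.mulMap_injective (n := n) u
  have hF : (1 : MvPolynomial (Fin n) ℂ) ≠ 0 := one_ne_zero
  have hC : (1 : CliffordAlgebra (TrigDaHCa.cliffForm n)) ≠ 0 := one_ne_zero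
  have hW : (1 : MonoidAlgebra ℂ (Equiv.Perm (Fin n))) ≠ 0 := one_ne_zero
  have hP : (1 : TrigDaHCa.GroupAlg n) ≠ 0 := one_ne_zero
  have hCF := TrigDaHCa.tmul_ne_zero hC hF
  refine ⟨⟨LinearEquiv.ofBijective (TrigDaHCa.mulMap n u)
    ⟨hinj, TrigDaHCa.mulMap_surjective u⟩, hΦ⟩, ?_, ?_, ?_, ?_⟩
  · refine fun x y h => TrigDaHCa.tmul_right_injective (TrigDaHCa.tmul_ne_zero hW hCF) (hinj ?_)
    have h1 := fun x => hΦ x 1 1 1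
    simp only [map_one, mul_one] at h1
    exact (h1 x).trans (h.trans (h1 y).symm)
  · refine fun x y h => TrigDaHCa.tmul_right_injective hCF
      (TrigDaHCa.tmul_left_injective hP (hinj ?_))
    have h1 := fun x => hΦ 1 x 1 1
    simp only [map_one, mul_one, one_mul] at h1
    exact (h1 x).trans (h.trans (h1 y).symm)
  · refine fun x y h => TrigDaHCa.tmul_right_injective hF (TrigDaHCa.tmul_left_injective hW
      (TrigDaHCa.tmul_left_injective hP (hinj ?_)))
    have h1 := fun x => hΦ 1 1 x 1
    simp only [map_one, mul_one, one_mul] at h1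
    exact (h1 x).trans (h.trans (h1 y).symm)
  · refine fun x y h => TrigDaHCa.tmul_left_injective hC (TrigDaHCa.tmul_left_injective hW
      (TrigDaHCa.tmul_left_injective hP (hinj ?_)))
    have h1 := fun x => hΦ 1 1 1 x
    simp only [map_one, one_mul] at h1
    exact (h1 x).trans (h.trans (h1 y).symm)
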